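/- **Setting.** Let $0<T\le 1$, $0<R_0\le\sqrt T$, write $B(x,r)$ for the open ball in $\mathbb R^3$ and $S(0,r)$ for the sphere, and consider the 3D Navier–Stokes equations $\partial_t u-\Delta u+(u\cdot\nabla)u+\nabla p=0$, $\operatorname{div}u=0$. A *global-in-time local Leray solution* is a field $u$ on $\mathbb R^3\times(0,\infty)$ such that, for some $p\in L^{3/2}_{loc}(\mathbb R^3\times(0,\infty))$ and some divergence-free $u_0\in L^2_{uloc}$: for every $\tau<\infty$, $u\in L^\infty((0,\tau);L^2_{uloc})$ and $\sup_{x_0}\int_0^\tau\!\int_{B(x_0,1)}|\nabla u|^2<\infty$; the equations hold in the sense of distributions; $u(\cdot,t)\to u_0$ in $L^2_{loc}$ as $t\to0^+$; and $2\iint|\nabla u|^2\varphi\le\iint|u|^2(\partial_t\varphi+\Delta\varphi)+(|u|^2+2p)\,u\cdot\nabla\varphi$ for all $0\le\varphi\in C_c^\infty(\mathbb R^3\times(0,\infty))$. It is *regular on $(0,T)$* if it is smooth on $\mathbb R^3\times(0,T)$. Put $\omega=\operatorname{curl}u$. **Cut-offs.** Fix $C_0>0$ and exponents $\tfrac12<\rho_1<1$,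 $\tfrac78\le\rho_2<1$. Let $\eta\in C^\infty(0,T)$ satisfy $0\le\eta\le1$, $\eta=0$ on $(0,T/3)$, $\eta=1$ on $(2T/3,T)$, $|\eta'|\le\frac{C_0}{T}\eta^{\rho_1}$. A *spatial cut-off at scale $R$* is a smooth compactly supported $\psi$ with $0\le\psi\le1$, $|\nabla\psi|\le\frac{C_0}{R}\psi^{\rho_2}$, $|\Delta\psi|\le\frac{C_0}{R^2}\psi^{2\rho_2-1}$. Let $\psi_0\in C_c^\infty(B(0,2R_0))$ be one at scale $R_0$ with $\psi_0=1$ on $B(0,R_0)$, and let $\phi_0=\psi_0\eta$. A cut-off $\psi$ *for the ball $B(x_0,R)$*, $0<R\le R_0$, is a spatial cut-off at scale $R$ with $\psi\le\psi_0$ such that: if $B(x_0,R)\subset B(0,R_0)$, then $\psi\in C_c^\infty(B(x_0,2R))$ and $\psi=1$ on $B(x_0,R)$, and $\psi=\psi_0$ in the case $x_0=0$, $R=R_0$; if $B(x_0,R)\not\subset B(0,R_0)$, then $\psi\in C_c^\infty(B(0,2R_0))$, $\psi=1$ on $B(x_0,R)\cap B(0,R_0)$, $\psi=\psi_0$ on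 the part between $S(0,R_0)$ and $S(0,2R_0)$ of the cone with vertex $0$ through $S(0,R_0)\cap B(x_0,R)$, and $\psi=0$ on $B(0,R_0)\setminus B(x_0,2R)$ and, between $S(0,R_0)$ and $S(0,2R_0)$, outside the cone with vertex $0$ through $S(0,R_0)\cap B(x_0,2R)$. **Covers and averages.** For positive integers $K_1,K_2$ a *$(K_1,K_2)$-cover at scale $R$* is a cover $\{B(x_i,R)\}_{i=1}^n$ of $B(0,R_0)$ with $(R_0/R)^3\le n\le K_1(R_0/R)^3$ such that every point of $B(0,R_0)$ lies in at most $K_2$ of the balls $B(x_i,2R)$. With cut-offs $\psi_i$ for the balls $B(x_i,R)$ and $\phi_i=\psi_i\eta$, let $$\langle VST\rangle_{R,t}=\frac1n\sum_{i=1}^n\frac1t\int_0^t\frac1{R^3}\int(\omega\cdot\nabla)u\cdot\phi_i\,\omega\,dx\,ds .$$ Further let $$E_{0,t}=\frac1t\int_0^t\frac1{R_0^3}\int\tfrac12|\omega|^2\phi_0^{1/2}\,dx\,ds,\qquad P_{0,t}=\frac1t\int_0^t\frac1{R_0^3}\int|\nabla\omega|^2\phi_0\,dx\,ds+\frac1t\frac1{R_0^3}\int\tfrac12|\omega(x,t)|^2\psi_0(x)\,dx,$$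 $$\sigma_{0,t}=\Bigl(\frac{E_{0,t}}{P_{0,t}}\Bigr)^{1/2}\ (\text{when }P_{0,t}>0),\qquad M_0=\sup_{0<s<T}\int_{B(0,2R_0)}|u(x,s)|^2\,dx .$$ **Theorem.** There is a constant $C>1$, depending only on $K_1,K_2$ (and on the cut-off constant $C_0$), such that the following holds for all $T,R_0,\rho_1,\rho_2,\eta,\psi_0$ as above. Let $u$ be a global-in-time local Leray solution on $\mathbb R^3\times(0,\infty)$ that is regular on $(0,T)$. Then $M_0<\infty$. If $t\in(2T/3,T)$ is such that $P_{0,t}>0$ and $$C\max\{M_0^{1/2},1\}\,\sigma_{0,t}^{1/2}<R_0,$$ then $$\frac1C\,P_{0,t}\le\langle VST\rangle_{R,t}\le C\,P_{0,t}$$ for every $R$ with $C\max\{M_0^{1/2},1\}\,\sigma_{0,t}^{1/2}\le R\le R_0$, every $(K_1,K_2)$-cover at scale $R$, and every choice of cut-offs $\psi_i$ for its elements. In particular $\langle VST\rangle_{R,t}>0$ across that range of scales. -/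

import Mathlib

open Set Filter Topology MeasureTheory Metric
open scoped ContDiff ENNReal NNReal InnerProductSpace Laplacian

noncomputable section

namespace VortexStretching

/-- Three-dimensional Euclidean space. -/
abbrev E3 : Type := EuclideanSpace ℝ (Fin 3)

/-- The standard basis vector `e_j`. -/
def e (j : Fin 3) : E3 := EuclideanSpace.single j 1

/-- The squared Frobenius norm `∑_{j,k} (A_{kj})²` of a linear map. -/
def frobSq (A : E3 →L[ℝ] E3) : ℝ := ∑ j, ‖A (e j)‖ ^ 2

/-- The partial derivative `∂_j v_k` at `x`. -/
def pd (v : E3 → E3) (j k : Fin 3) (x : E3) : ℝ := fderiv ℝ v x (e j) k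

/-- The curl of a vector field. -/
def curl (v : E3 → E3) (x : E3) : E3 :=
  !₂[pd v 1 2 x - pd v 2 1 x, pd v 2 0 x - pd v 0 2 x, pd v 0 1 x - pd v 1 0 x]

/-! ### Local Leray solutions -/

/-- Test functions in `C_c^∞((0,∞) × ℝ³; F)`, with time as first coordinate. -/
structure IsTest {F : Type} [NormedAddCommGroup F] [NormedSpace ℝ F] (φ : ℝ × E3 → F) : Prop where
  smooth : ContDiff ℝ ∞ φ
  compact : HasCompactSupport φ
  supp : tsupport φ ⊆ Ioi (0 : ℝ) ×ˢ (univ : Set E3)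

/-- The time derivative of a function on space-time. -/
def dt {F : Type} [NormedAddCommGroup F] [NormedSpace ℝ F] (φ : ℝ × E3 → F) (z : ℝ × E3) : F :=
  fderiv ℝ φ z (1, 0)

/-- The spatial derivative, in the direction `v`, of a function on space-time. -/
def dx {F : Type} [NormedAddCommGroup F] [NormedSpace ℝ F] (φ : ℝ × E3 → F) (z : ℝ × E3)
    (v : E3) : F :=
  fderiv ℝ φ z (0, v)

/-- The spatial Laplacian of a function on space-time. -/
def lap {F : Type} [NormedAddCommGroup F] [NormedSpace ℝ F] (φ : ℝ × E3 → F) (z : ℝ × E3) : F :=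
  Δ (fun y : E3 => φ (z.1, y)) z.2

/-- `v ∈ L²_uloc(ℝ³)`, with uniformly local bound `M`. -/
def UlocBound (v : E3 → E3) (M : ℝ≥0) : Prop :=
  ∀ x₀ : E3, ∫⁻ x in ball x₀ 1, ‖v x‖ₑ ^ 2 ≤ M

/-- Divergence-free initial data in `L²_uloc(ℝ³)`. -/
structure IsUlocData (u₀ : E3 → E3) : Prop where
  meas : AEStronglyMeasurable u₀ volume
  uloc : ∃ M : ℝ≥0, UlocBound u₀ M
  div_free : ∀ χ : E3 → ℝ, ContDiff ℝ ∞ χ → HasCompactSupport χ →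
    ∫ x, fderiv ℝ χ x (u₀ x) = 0

/-- `u` is a local Leray solution of the Navier-Stokes equations (unit viscosity, no force) on
`ℝ³ × (0,∞)` with initial datum `u₀`, weak spatial gradient `G` and pressure `p`. -/
structure IsLocalLerayWith (u₀ : E3 → E3) (u : ℝ → E3 → E3) (G : ℝ → E3 → (E3 →L[ℝ] E3))
    (p : ℝ → E3 → ℝ) : Prop where
  data : IsUlocData u₀
  meas : AEStronglyMeasurable (fun z : ℝ × E3 => u z.1 z.2)
    (volume.restrict (Ioi (0 : ℝ) ×ˢ (univ : Set E3)))
  grad_meas : AEStronglyMeasurable (fun z : ℝ × E3 => G z.1 z.2)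
    (volume.restrict (Ioi (0 : ℝ) ×ˢ (univ : Set E3)))
  /-- `u ∈ L^∞((0,τ); L²_uloc)` for every finite `τ`. -/
  energy : ∀ τ : ℝ, 0 < τ → ∃ M : ℝ≥0,
    ∀ᵐ s ∂(volume.restrict (Ioo (0 : ℝ) τ)), UlocBound (u s) M
  /-- `G` is the weak spatial gradient of `u`. -/
  weak_grad : ∀ φ : ℝ × E3 → ℝ, IsTest φ → ∀ j : Fin 3,
    ∫ z : ℝ × E3, dx φ z (e j) • u z.1 z.2 = - ∫ z : ℝ × E3, φ z • G z.1 z.2 (e j)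
  /-- The gradient is uniformly locally square integrable on `(0,τ) × ℝ³`, for finite `τ`. -/
  dissipation : ∀ τ : ℝ, 0 < τ → ∃ M : ℝ≥0, ∀ x₀ : E3,
    ∫⁻ z in Ioo (0 : ℝ) τ ×ˢ ball x₀ 1, ENNReal.ofReal (frobSq (G z.1 z.2)) ≤ M
  /-- `p ∈ L^{3/2}_loc((0,∞) × ℝ³)`. -/
  pressure : ∀ K : Set (ℝ × E3), IsCompact K → K ⊆ Ioi (0 : ℝ) ×ˢ (univ : Set E3) →
    MemLp (fun z : ℝ × E3 => p z.1 z.2) (3 / 2) (volume.restrict K)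
  /-- `div u = 0` in the sense of distributions. -/
  div_free : ∀ φ : ℝ × E3 → ℝ, IsTest φ → ∫ z : ℝ × E3, dx φ z (u z.1 z.2) = 0
  /-- `∂ₜ u - Δ u + div (u ⊗ u) + ∇ p = 0` in the sense of distributions. -/
  momentum : ∀ ζ : ℝ × E3 → E3, IsTest ζ →
    ∫ z : ℝ × E3, (⟪u z.1 z.2, dt ζ z + lap ζ z⟫_ℝ + ⟪u z.1 z.2, dx ζ z (u z.1 z.2)⟫_ℝ
      + p z.1 z.2 * ∑ j, dx ζ z (e j) j) = 0
  /-- The initial datum is attained in `L²_loc(ℝ³)` (an essential limit, as `u` is determined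
  only up to null sets of times). -/
  initial : ∀ K : Set E3, IsCompact K →
    Tendsto (fun s : ℝ => ∫⁻ x in K, ‖u s x - u₀ x‖ₑ ^ 2) (𝓝[>] (0 : ℝ) ⊓ ae volume) (𝓝 0)
  /-- The local energy inequality. -/
  local_energy : ∀ φ : ℝ × E3 → ℝ, IsTest φ → (∀ z, 0 ≤ φ z) →
    2 * ∫ z : ℝ × E3, frobSq (G z.1 z.2) * φ z ≤
      ∫ z : ℝ × E3, (‖u z.1 z.2‖ ^ 2 * (dt φ z + lap φ z)
        + (‖u z.1 z.2‖ ^ 2 + 2 * p z.1 z.2) * dx φ z (u z.1 z.2))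

/-- `u` is a global-in-time local Leray solution on `ℝ³ × (0,∞)`. -/
def IsLocalLeray (u : ℝ → E3 → E3) : Prop := ∃ u₀ G p, IsLocalLerayWith u₀ u G p

/-- `u` is regular (smooth) on the time interval `(0,T)`. -/
def IsRegularOn (u : ℝ → E3 → E3) (T : ℝ) : Prop :=
  ContDiffOn ℝ ∞ (fun z : ℝ × E3 => u z.1 z.2) (Ioo (0 : ℝ) T ×ˢ (univ : Set E3))

/-! ### Cut-off functions -/

/-- Temporal cut-off functions on `(0,T)`. -/
structure IsTimeCutoff (C₀ ρ₁ T : ℝ) (η : ℝ → ℝ) : Prop where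
  smooth : ContDiffOn ℝ ∞ η (Ioo 0 T)
  nonneg : ∀ s ∈ Ioo 0 T, 0 ≤ η s
  le_one : ∀ s ∈ Ioo 0 T, η s ≤ 1
  eq_zero : ∀ s ∈ Ioo 0 (T / 3), η s = 0
  eq_one : ∀ s ∈ Ioo (2 * T / 3) T, η s = 1
  deriv_le : ∀ s ∈ Ioo 0 T, |deriv η s| ≤ C₀ / T * η s ^ ρ₁

/-- Spatial cut-off functions at scale `R`: `ψ ∈ C_c^∞(U)` with `ψ = 1` on `A`. -/
structure IsSpaceCutoff (C₀ ρ₂ R : ℝ) (U A : Set E3) (ψ : E3 → ℝ) : Prop where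
  smooth : ContDiff ℝ ∞ ψ
  compact : HasCompactSupport ψ
  supp : tsupport ψ ⊆ U
  nonneg : ∀ x, 0 ≤ ψ x
  le_one : ∀ x, ψ x ≤ 1
  eq_one : ∀ x ∈ A, ψ x = 1
  grad_le : ∀ x, ‖fderiv ℝ ψ x‖ ≤ C₀ / R * ψ x ^ ρ₂
  lap_le : ∀ x, |Δ ψ x| ≤ C₀ / R ^ 2 * ψ x ^ (2 * ρ₂ - 1)

/-- The part, between the spheres `S(0,R₀)` and `S(0,2R₀)`, of the cone centered at zero that
passes through `S(0,R₀) ∩ B(x₀,r)`. -/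
def coneShell (R₀ : ℝ) (x₀ : E3) (r : ℝ) : Set E3 :=
  {x | R₀ ≤ ‖x‖ ∧ ‖x‖ ≤ 2 * R₀ ∧ ∃ y ∈ sphere (0 : E3) R₀ ∩ ball x₀ r, ∃ l : ℝ, 0 ≤ l ∧ x = l • y}

/-- Admissible spatial cut-off functions `ψ = ψ_{x₀,R}` for the cover element `B(x₀,R)`, relative
to the macro-scale cut-off `ψ₀ = ψ_{0,R₀}`. -/
structure IsCoverCutoff (C₀ ρ₂ R₀ R : ℝ) (ψ₀ : E3 → ℝ) (x₀ : E3) (ψ : E3 → ℝ) : Prop where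
  le_macro : ∀ x, ψ x ≤ ψ₀ x
  /-- The cut-off corresponding to the center `0` and the scale `R₀` is `ψ₀` itself. -/
  at_origin : x₀ = 0 → R = R₀ → ψ = ψ₀
  interior : ball x₀ R ⊆ ball 0 R₀ → IsSpaceCutoff C₀ ρ₂ R (ball x₀ (2 * R)) (ball x₀ R) ψ
  boundary : ¬ ball x₀ R ⊆ ball 0 R₀ →
    IsSpaceCutoff C₀ ρ₂ R (ball 0 (2 * R₀)) (ball x₀ R ∩ ball 0 R₀) ψ ∧
    (∀ x ∈ coneShell R₀ x₀ R, ψ x = ψ₀ x) ∧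
    (∀ x ∈ ball 0 R₀ \ ball x₀ (2 * R), ψ x = 0) ∧
    (∀ x, R₀ ≤ ‖x‖ → ‖x‖ ≤ 2 * R₀ → x ∉ coneShell R₀ x₀ (2 * R) → ψ x = 0)

/-- `{B(x_i,R)}` is a `(K₁,K₂)`-cover of `B(0,R₀)` at scale `R`. -/
structure IsKCover (K₁ K₂ : ℕ) (R₀ R : ℝ) {n : ℕ} (x : Fin n → E3) : Prop where
  pos : 0 < R
  le_macro : R ≤ R₀
  covers : ball 0 R₀ ⊆ ⋃ i, ball (x i) R
  card_ge : (R₀ / R) ^ 3 ≤ n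
  card_le : n ≤ K₁ * (R₀ / R) ^ 3
  multiplicity : ∀ y ∈ ball (0 : E3) R₀, {i | y ∈ ball (x i) (2 * R)}.ncard ≤ K₂

/-! ### The averaged quantities -/

/-- `M₀ = sup_{0<s<T} ∫_{B(0,2R₀)} |u(x,s)|² dx`. -/
def M0 (u : ℝ → E3 → E3) (T R₀ : ℝ) : ℝ≥0∞ :=
  ⨆ s ∈ Ioo 0 T, ∫⁻ x in ball 0 (2 * R₀), ‖u s x‖ₑ ^ 2

/-- The time-averaged localized enstrophy per unit mass `E_{0,t}`. -/
def E0 (u : ℝ → E3 → E3) (η : ℝ → ℝ) (ψ₀ : E3 → ℝ) (R₀ t : ℝ) : ℝ :=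
  1 / t * ∫ s in 0..t, 1 / R₀ ^ 3 *
    ∫ x, 1 / 2 * ‖curl (u s) x‖ ^ 2 * (ψ₀ x * η s) ^ (1 / 2 : ℝ)

/-- The modified time-averaged localized palinstrophy per unit mass `P_{0,t}`. -/
def P0 (u : ℝ → E3 → E3) (η : ℝ → ℝ) (ψ₀ : E3 → ℝ) (R₀ t : ℝ) : ℝ :=
  1 / t * (∫ s in 0..t, 1 / R₀ ^ 3 *
      ∫ x, frobSq (fderiv ℝ (curl (u s)) x) * (ψ₀ x * η s))
    + 1 / t * (1 / R₀ ^ 3) * ∫ x, 1 / 2 * ‖curl (u t) x‖ ^ 2 * ψ₀ x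

/-- The Kraichnan-type scale `σ_{0,t} = (E_{0,t} / P_{0,t})^{1/2}`. -/
def sigma0 (u : ℝ → E3 → E3) (η : ℝ → ℝ) (ψ₀ : E3 → ℝ) (R₀ t : ℝ) : ℝ :=
  √(E0 u η ψ₀ R₀ t / P0 u η ψ₀ R₀ t)

/-- The time-averaged localized vortex-stretching term per unit mass,
`(1/t) ∫_0^t R⁻³ ∫ (ω·∇)u · ψ η ω dx ds`. -/
def VST (u : ℝ → E3 → E3) (η : ℝ → ℝ) (ψ : E3 → ℝ) (R t : ℝ) : ℝ :=
  1 / t * ∫ s in 0..t, 1 / R ^ 3 *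
    ∫ x, ⟪fderiv ℝ (u s) x (curl (u s) x), (ψ x * η s) • curl (u s) x⟫_ℝ

/-- The ensemble average `⟨VST⟩_{R,t}`. -/
def VSTavg (u : ℝ → E3 → E3) (η : ℝ → ℝ) {n : ℕ} (ψ : Fin n → E3 → ℝ) (R t : ℝ) : ℝ :=
  1 / (n : ℝ) * ∑ i, VST u η (ψ i) R t

end VortexStretching

end

open VortexStretching

/-!
Write `ω = curl u`, `h = ½|ω|²`, and let `Ψ` be the sum of the cut-offs of the cover. Since `u` is
smooth on `(0,T)`, testing the weak momentum equation with curls removes the pressure and shows that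
`∂ₜu - Δu + div (u ⊗ u)` is curl-free, which is the vorticity equation (`vorticity_equation`).
Multiplying it by `Ψ η ω` and integrating over `ℝ³ × (0,t)` gives
(`intervalIntegral_enstrophy_balance`)

`∬ (ω·∇)u·ω Ψη = ∫ h(t) Ψ + ∬ |∇ω|² Ψη - ∬ h (Ψη' + ηΔΨ) - ∬ h η u·∇Ψ`.

The geometry of the cover yields `ψ₀ ≤ Ψ ≤ K₂ ψ₀` together with `|∇Ψ| ≲ R⁻¹ ψ₀^{7/8}` and
`|ΔΨ| ≲ R⁻² ψ₀^{1/2}` (`isAggregate_sum`). Hence the first two terms on the right are comparable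
to the palinstrophy `P₀`, and the third one is at most a multiple of `R⁻² E₀ = R⁻² σ² P₀`. For the
last one, Hölder's inequality, the Sobolev inequality for `ψ₀^{1/2} ω` and Young's inequality
bound `∫ |u| |ω|² ψ₀^{7/8}` at each time by `√M₀ (λ³ e + g / λ)`, where `e` and `g` are the
integrals of `|ω|² ψ₀^{1/2}` and `|∇(ψ₀^{1/2} ω)|²` and `λ > 0` is free
(`IsEighthRoot.integral_transport_le`); as `λ` does not depend on time, this integrates in time
directly. With `λ = C max(√M₀, 1) / R` the hypothesis on `R` makes all error terms together at most
half of the main terms (`error_le_half`, `stretch_comparable`); the constant `C` absorbs `C₀`, `K₁`,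
`K₂` and the Sobolev constant. Dividing by `n R³`, which lies between `R₀³` and `K₁ R₀³`, gives the
two-sided bound.
-/

namespace VortexStretching

/-! ### Directional derivatives and integration by parts against bump functions -/

section Calculus

variable {E : Type*} [NormedAddCommGroup E] [NormedSpace ℝ E]

/-- The directional derivative `∂_v f` of a scalar function, as a function of the point. -/
noncomputable def dd (v : E) (f : E → ℝ) (z : E) : ℝ := fderiv ℝ f z v

variable {Ω : Set E} {f g : E → ℝ} {v w z : E}

theorem differentiableAt_of_smoothOn (hΩ : IsOpen Ω) (hf : ContDiffOn ℝ ∞ f Ω) (hz : z ∈ Ω) :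
    DifferentiableAt ℝ f z :=
  (hf.contDiffAt (hΩ.mem_nhds hz)).differentiableAt (by simp)

theorem dd_smoothOn (hΩ : IsOpen Ω) (hf : ContDiffOn ℝ ∞ f Ω) (v : E) :
    ContDiffOn ℝ ∞ (dd v f) Ω :=
  (hf.fderiv_of_isOpen (m := ∞) hΩ (by simp)).clm_apply contDiffOn_const

theorem dd_add (hΩ : IsOpen Ω) (hf : ContDiffOn ℝ ∞ f Ω) (hg : ContDiffOn ℝ ∞ g Ω)
    (hz : z ∈ Ω) : dd v (fun y => f y + g y) z = dd v f z + dd v g z := by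
  have h1 := differentiableAt_of_smoothOn hΩ hf hz
  have h2 := differentiableAt_of_smoothOn hΩ hg hz
  simp only [dd]
  rw [fderiv_fun_add h1 h2]; rfl

theorem dd_sub (hΩ : IsOpen Ω) (hf : ContDiffOn ℝ ∞ f Ω) (hg : ContDiffOn ℝ ∞ g Ω)
    (hz : z ∈ Ω) : dd v (fun y => f y - g y) z = dd v f z - dd v g z := by
  have h1 := differentiableAt_of_smoothOn hΩ hf hz
  have h2 := differentiableAt_of_smoothOn hΩ hg hz
  simp only [dd]
  rw [fderiv_fun_sub h1 h2]; rfl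

theorem dd_mul (hΩ : IsOpen Ω) (hf : ContDiffOn ℝ ∞ f Ω) (hg : ContDiffOn ℝ ∞ g Ω)
    (hz : z ∈ Ω) : dd v (fun y => f y * g y) z = f z * dd v g z + g z * dd v f z := by
  have h1 := differentiableAt_of_smoothOn hΩ hf hz
  have h2 := differentiableAt_of_smoothOn hΩ hg hz
  simp only [dd]
  rw [fderiv_fun_mul h1 h2]; rfl

theorem dd_const_mul (hΩ : IsOpen Ω) (hf : ContDiffOn ℝ ∞ f Ω) (c : ℝ)
    (hz : z ∈ Ω) : dd v (fun y => c * f y) z = c * dd v f z := by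
  have h1 := differentiableAt_of_smoothOn hΩ hf hz
  simp only [dd]
  rw [fderiv_const_mul h1]; rfl

theorem smoothOn_sum {ι : Type*} (s : Finset ι) {F : ι → E → ℝ}
    (hF : ∀ i ∈ s, ContDiffOn ℝ ∞ (F i) Ω) : ContDiffOn ℝ ∞ (fun y => ∑ i ∈ s, F i y) Ω :=
  ContDiffOn.sum hF

theorem dd_sum (hΩ : IsOpen Ω) {ι : Type*} (s : Finset ι) {F : ι → E → ℝ}
    (hF : ∀ i ∈ s, ContDiffOn ℝ ∞ (F i) Ω) (hz : z ∈ Ω) :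
    dd v (fun y => ∑ i ∈ s, F i y) z = ∑ i ∈ s, dd v (F i) z := by
  simp only [dd]
  rw [fderiv_fun_sum fun i hi => differentiableAt_of_smoothOn hΩ (hF i hi) hz]
  simp

theorem dd_congr (hΩ : IsOpen Ω) (h : ∀ y ∈ Ω, f y = g y) (hz : z ∈ Ω) :
    dd v f z = dd v g z := by
  simp only [dd]
  rw [Filter.EventuallyEq.fderiv_eq (Filter.eventually_of_mem (hΩ.mem_nhds hz) h)]

theorem dd_comm (hΩ : IsOpen Ω) (hf : ContDiffOn ℝ ∞ f Ω) (hz : z ∈ Ω) (v w : E) :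
    dd v (dd w f) z = dd w (dd v f) z := by
  have h1 : DifferentiableAt ℝ (fderiv ℝ f) z :=
    ((hf.fderiv_of_isOpen (m := ∞) hΩ (by simp)).contDiffAt (hΩ.mem_nhds hz)).differentiableAt
      (by simp)
  have key : ∀ a b : E, dd a (dd b f) z = fderiv ℝ (fderiv ℝ f) z a b := by
    intro a b
    show fderiv ℝ (fun y => fderiv ℝ f y b) z a = _
    rw [fderiv_clm_apply h1 (differentiableAt_const b)]
    simp
  rw [key, key]
  exact ((hf.contDiffAt (hΩ.mem_nhds hz)).isSymmSndFDerivAt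
    (by simpa using ENat.LEInfty.out)).eq v w

theorem tsupport_dd_subset (v : E) (f : E → ℝ) : tsupport (dd v f) ⊆ tsupport f :=
  tsupport_fderiv_apply_subset ℝ v

/-- A smooth compactly supported function whose support lies in the open set `Ω`. -/
structure IsBump (Ω : Set E) (ξ : E → ℝ) : Prop where
  smooth : ContDiff ℝ ∞ ξ
  compact : HasCompactSupport ξ
  supp : tsupport ξ ⊆ Ω

theorem IsBump.dd {ξ : E → ℝ} (h : IsBump Ω ξ) (v : E) : IsBump Ω (dd v ξ) where
  smooth := contDiffOn_univ.1 (dd_smoothOn isOpen_univ (contDiffOn_univ.2 h.smooth) v)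
  compact := h.compact.of_isClosed_subset (isClosed_tsupport _) (tsupport_dd_subset v ξ)
  supp := (tsupport_dd_subset v ξ).trans h.supp

theorem IsBump.continuous_mul {ξ : E → ℝ} (h : IsBump Ω ξ) (hΩ : IsOpen Ω)
    (hf : ContinuousOn f Ω) : Continuous fun z => f z * ξ z := by
  refine continuous_of_tsupport fun z hz => ?_
  have hz' : z ∈ Ω := h.supp (tsupport_mul_subset_right hz)
  exact (hf.continuousAt (hΩ.mem_nhds hz')).mul h.smooth.continuous.continuousAt

theorem IsBump.integrable_mul [MeasurableSpace E] [BorelSpace E] {μ : Measure E}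
    [IsFiniteMeasureOnCompacts μ] {ξ : E → ℝ} (h : IsBump Ω ξ) (hΩ : IsOpen Ω)
    (hf : ContinuousOn f Ω) : Integrable (fun z => f z * ξ z) μ :=
  (h.continuous_mul hΩ hf).integrable_of_hasCompactSupport h.compact.mul_left

/-- Integration by parts against a bump function supported in `Ω`, for a function that is only
known to be smooth on `Ω`. -/
theorem IsBump.integral_mul_dd [MeasurableSpace E] [BorelSpace E] [FiniteDimensional ℝ E]
    {μ : Measure E} [μ.IsAddHaarMeasure] {ξ : E → ℝ} (h : IsBump Ω ξ) (hΩ : IsOpen Ω)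
    (hf : ContDiffOn ℝ ∞ f Ω) (v : E) :
    ∫ z, f z * VortexStretching.dd v ξ z ∂μ = - ∫ z, VortexStretching.dd v f z * ξ z ∂μ :=
  integral_mul_fderiv_eq_neg_fderiv_mul_of_integrable
    (h.integrable_mul hΩ (dd_smoothOn hΩ hf v).continuousOn)
    ((h.dd v).integrable_mul hΩ hf.continuousOn) (h.integrable_mul hΩ hf.continuousOn)
    (fun _ hz => differentiableAt_of_smoothOn hΩ hf (h.supp hz))
    (fun z _ => h.smooth.differentiable (by simp) z)

/-- The fundamental lemma of the calculus of variations for continuous functions. -/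
theorem eq_zero_of_integral_mul_bump_eq_zero [MeasurableSpace E] [BorelSpace E]
    [FiniteDimensional ℝ E] {μ : Measure E} [μ.IsAddHaarMeasure] (hΩ : IsOpen Ω)
    (hf : ContinuousOn f Ω) (h : ∀ ξ, IsBump Ω ξ → ∫ z, f z * ξ z ∂μ = 0) :
    ∀ z ∈ Ω, f z = 0 := by
  have hae : ∀ᵐ z ∂μ, z ∈ Ω → f z = 0 := by
    refine hΩ.ae_eq_zero_of_integral_contDiff_smul_eq_zero
      (hf.locallyIntegrableOn hΩ.measurableSet) fun ξ h1 h2 h3 => ?_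
    simpa only [smul_eq_mul, mul_comm] using h ξ ⟨h1, h2, h3⟩
  have : f =ᵐ[μ.restrict Ω] fun _ => 0 := by
    rwa [Filter.EventuallyEq, ae_restrict_iff' hΩ.measurableSet]
  exact fun z hz => Measure.eqOn_open_of_ae_eq this hΩ hf continuousOn_const hz

end Calculus

/-! ### From the weak formulation to the pointwise equations -/

/-- The space-time slab `(0,T) × ℝ³`. -/
def slab (T : ℝ) : Set (ℝ × E3) := Ioo (0 : ℝ) T ×ˢ univ

theorem isOpen_slab (T : ℝ) : IsOpen (slab T) := isOpen_Ioo.prod isOpen_univ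

theorem mem_slab {T s : ℝ} (hs : s ∈ Ioo (0 : ℝ) T) (x : E3) : (s, x) ∈ slab T := ⟨hs, mem_univ _⟩

/-- The unit vector in the time direction. -/
noncomputable def et : ℝ × E3 := (1, 0)

/-- The unit vector in the `l`-th space direction. -/
noncomputable def ex (l : Fin 3) : ℝ × E3 := (0, e l)

/-- The `k`-th component of a time-dependent vector field, as a function on space-time. -/
def comp (u : ℝ → E3 → E3) (k : Fin 3) (z : ℝ × E3) : ℝ := u z.1 z.2 k

/-- The `k`-th component of the vorticity, as a function on space-time; the indices `k + 1` and
`k + 2` are taken modulo `3`. -/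
noncomputable def vort (u : ℝ → E3 → E3) (k : Fin 3) (z : ℝ × E3) : ℝ :=
  dd (ex (k + 1)) (comp u (k + 2)) z - dd (ex (k + 2)) (comp u (k + 1)) z

/-- The `k`-th component of `∂ₜu - Δu + div (u ⊗ u)`. -/
noncomputable def force (u : ℝ → E3 → E3) (k : Fin 3) (z : ℝ × E3) : ℝ :=
  dd et (comp u k) z - ∑ l, dd (ex l) (dd (ex l) (comp u k)) z
    + ∑ l, dd (ex l) (fun y => comp u k y * comp u l y) z

instance : (volume : Measure (ℝ × E3)).IsAddHaarMeasure :=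
  inferInstanceAs ((volume : Measure ℝ).prod (volume : Measure E3)).IsAddHaarMeasure

theorem sum_coord_smul_e (v : E3) : v = ∑ l, v l • e l := by
  ext i
  simp [e, Pi.single_apply]

section

variable {X : Type*} [NormedAddCommGroup X] [NormedSpace ℝ X]

theorem fderiv_coord {ζ : X → E3} {z : X} (h : DifferentiableAt ℝ ζ z) (v : X) (k : Fin 3) :
    (fderiv ℝ ζ z v) k = dd v (fun y => ζ y k) z := by
  have h1 := ((EuclideanSpace.proj k : E3 →L[ℝ] ℝ).hasFDerivAt.comp z
    h.hasFDerivAt).fderiv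
  have h2 : (⇑(EuclideanSpace.proj k : E3 →L[ℝ] ℝ) ∘ ζ)
    = fun y => ζ y k := rfl
  rw [h2] at h1
  simp only [dd, h1]
  rfl

theorem laplacian_eq_sum {F : Type*} [NormedAddCommGroup F] [NormedSpace ℝ F] (f : E3 → F)
    (x : E3) : Δ f x = ∑ l, fderiv ℝ (fderiv ℝ f) x (e l) (e l) := by
  rw [InnerProductSpace.laplacian_eq_iteratedFDeriv_orthonormalBasis f
    (EuclideanSpace.basisFun (Fin 3) ℝ)]
  refine Finset.sum_congr rfl fun l _ => ?_
  rw [iteratedFDeriv_two_apply]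
  simp [e]

theorem laplacian_eq_sum_dd {f : E3 → ℝ} (hf : ContDiff ℝ ∞ f) (x : E3) :
    Δ f x = ∑ l, dd (e l) (dd (e l) f) x := by
  rw [laplacian_eq_sum]
  refine Finset.sum_congr rfl fun l _ => ?_
  have h1 : DifferentiableAt ℝ (fderiv ℝ f) x :=
    (hf.fderiv_right (m := ∞) (by simp)).differentiable (by simp) x
  show _ = fderiv ℝ (fun y => fderiv ℝ f y (e l)) x (e l)
  rw [fderiv_clm_apply h1 (differentiableAt_const _)]
  simp

end

/-- Spatial derivatives of a function at a fixed time are space-time derivatives. -/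
theorem fderiv_slice {F : Type*} [NormedAddCommGroup F] [NormedSpace ℝ F] {f : ℝ × E3 → F}
    {s : ℝ} {x : E3} (hf : DifferentiableAt ℝ f (s, x)) (v : E3) :
    fderiv ℝ (fun y => f (s, y)) x v = fderiv ℝ f (s, x) (0, v) := by
  have h := hf.hasFDerivAt.comp x (hasFDerivAt_prodMk_right (𝕜 := ℝ) s x)
  have h' : HasFDerivAt (fun y => f (s, y))
    ((fderiv ℝ f (s, x)).comp (ContinuousLinearMap.inr ℝ ℝ E3)) x := h
  rw [h'.fderiv]
  simp

theorem dd_slice {f : ℝ × E3 → ℝ} {s : ℝ} {x : E3} (hf : DifferentiableAt ℝ f (s, x))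
    (l : Fin 3) : dd (e l) (fun y => f (s, y)) x = dd (ex l) f (s, x) :=
  fderiv_slice hf _

theorem coord_contDiff {ζ : ℝ × E3 → E3} (h : ContDiff ℝ ∞ ζ) (k : Fin 3) :
    ContDiff ℝ ∞ fun z => ζ z k := contDiff_euclidean.1 h k

theorem lap_coord {ζ : ℝ × E3 → E3} (h : ContDiff ℝ ∞ ζ) (z : ℝ × E3) (k : Fin 3) :
    lap ζ z k = ∑ l, dd (ex l) (dd (ex l) (fun y => ζ y k)) z := by
  have hs : ContDiff ℝ ∞ fun y : E3 => ζ (z.1, y) := h.comp (contDiff_prodMk_right z.1)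
  have hk := coord_contDiff h k
  rw [lap, laplacian_eq_sum]
  rw [WithLp.ofLp_sum, Finset.sum_apply]
  refine Finset.sum_congr rfl fun l _ => ?_
  have h1 : DifferentiableAt ℝ (fderiv ℝ fun y : E3 => ζ (z.1, y)) z.2 :=
    (hs.fderiv_right (m := ∞) (by simp)).differentiable (by simp) z.2
  have h2 : fderiv ℝ (fderiv ℝ fun y : E3 => ζ (z.1, y)) z.2 (e l) (e l)
      = fderiv ℝ (fun x => fderiv ℝ (fun y : E3 => ζ (z.1, y)) x (e l)) z.2 (e l) := by
    rw [fderiv_clm_apply h1 (differentiableAt_const _)]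
    simp
  rw [h2, fderiv_coord (by fun_prop)]
  have h3 : (fun y => (fderiv ℝ (fun y : E3 => ζ (z.1, y)) y (e l)) k)
      = fun y => dd (ex l) (fun y => ζ y k) (z.1, y) := by
    funext y
    rw [fderiv_coord (hs.differentiable (by simp) y)]
    exact dd_slice (hk.differentiable (by simp) _) l
  rw [h3]
  have h4 : ContDiff ℝ ∞ (dd (ex l) fun y => ζ y k) :=
    contDiffOn_univ.1 (dd_smoothOn isOpen_univ (contDiffOn_univ.2 hk) _)
  exact dd_slice (h4.differentiable (by simp) (z.1, z.2)) l

theorem inner_eq_sum (v w : E3) : ⟪v, w⟫_ℝ = ∑ k, v k * w k := by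
  simp [PiLp.inner_apply, mul_comm]

theorem comp_smoothOn {u : ℝ → E3 → E3} {T : ℝ} (hu : IsRegularOn u T) (k : Fin 3) :
    ContDiffOn ℝ ∞ (comp u k) (slab T) := contDiffOn_euclidean.1 hu k

theorem slab_subset (T : ℝ) : slab T ⊆ Ioi (0 : ℝ) ×ˢ (univ : Set E3) :=
  prod_mono (fun _ h => h.1) Subset.rfl

section LocalLeray

variable {u₀ : E3 → E3} {u : ℝ → E3 → E3} {G : ℝ → E3 → (E3 →L[ℝ] E3)} {p : ℝ → E3 → ℝ} {T : ℝ}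

theorem fderiv_apply_eq_sum {ζ : ℝ × E3 → ℝ} (z : ℝ × E3) (v : E3) :
    fderiv ℝ ζ z (0, v) = ∑ l, v l * dd (ex l) ζ z := by
  have : ((0 : ℝ), v) = ∑ l, v l • ex l := by
    have h := sum_coord_smul_e v
    simp only [ex, Prod.smul_mk, smul_zero]
    refine Prod.ext ?_ ?_
    · simp [Prod.fst_sum]
    · simpa [Prod.snd_sum] using h
  rw [this, map_sum]
  simp [dd]

theorem divergence_eq_zero (h : IsLocalLerayWith u₀ u G p) (hu : IsRegularOn u T) :
    ∀ z ∈ slab T, ∑ l, dd (ex l) (comp u l) z = 0 := by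
  have hU := comp_smoothOn hu
  have hD := fun l => dd_smoothOn (isOpen_slab T) (hU l) (ex l)
  refine eq_zero_of_integral_mul_bump_eq_zero (μ := volume) (isOpen_slab T)
    (smoothOn_sum _ fun l _ => hD l).continuousOn fun ξ hξ => ?_
  have h0 := h.div_free ξ ⟨hξ.smooth, hξ.compact, hξ.supp.trans (slab_subset T)⟩
  have h1 : ∀ z, dx ξ z (u z.1 z.2) = ∑ l, comp u l z * dd (ex l) ξ z :=
    fun z => fderiv_apply_eq_sum z _
  simp only [h1] at h0
  rw [integral_finsetSum _ fun l _ => (hξ.dd _).integrable_mul (isOpen_slab T)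
    (hU l).continuousOn] at h0
  simp only [hξ.integral_mul_dd (isOpen_slab T) (hU _)] at h0
  simp only [Finset.sum_mul]
  rw [integral_finsetSum _ fun l _ => hξ.integrable_mul (isOpen_slab T) (hD l).continuousOn]
  simpa using h0

theorem force_smoothOn (hu : IsRegularOn u T) (k : Fin 3) :
    ContDiffOn ℝ ∞ (force u k) (slab T) := by
  have hU := comp_smoothOn hu
  have hO := isOpen_slab T
  exact ((dd_smoothOn hO (hU k) _).sub (smoothOn_sum _ fun l _ =>
    dd_smoothOn hO (dd_smoothOn hO (hU k) _) _)).add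
    (smoothOn_sum _ fun l _ => dd_smoothOn hO ((hU k).mul (hU l)) _)

/-- One component of the weak momentum equation, after integrating by parts; the integrability is
recorded because the components are summed under the integral sign. -/
theorem integral_force_mul (hu : IsRegularOn u T) (k : Fin 3) {ξ : ℝ × E3 → ℝ}
    (hξ : IsBump (slab T) ξ) :
    Integrable (fun z => comp u k z * (dd et ξ z + ∑ l, dd (ex l) (dd (ex l) ξ) z)
      + ∑ l, comp u k z * comp u l z * dd (ex l) ξ z) ∧
    ∫ z, (comp u k z * (dd et ξ z + ∑ l, dd (ex l) (dd (ex l) ξ) z)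
      + ∑ l, comp u k z * comp u l z * dd (ex l) ξ z) = - ∫ z, force u k z * ξ z := by
  have hU := comp_smoothOn hu
  have hO := isOpen_slab T
  have i1 := (hξ.dd et).integrable_mul (μ := volume) hO (hU k).continuousOn
  have i2 := fun l => ((hξ.dd (ex l)).dd (ex l)).integrable_mul (μ := volume) hO
    (hU k).continuousOn
  have i3 := fun l => (hξ.dd (ex l)).integrable_mul (μ := volume) hO
    ((hU k).mul (hU l)).continuousOn
  have j1 := hξ.integrable_mul (μ := volume) hO (dd_smoothOn hO (hU k) et).continuousOn
  have j2 := fun l => hξ.integrable_mul (μ := volume) hO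
    (dd_smoothOn hO (dd_smoothOn hO (hU k) (ex l)) (ex l)).continuousOn
  have j3 := fun l => hξ.integrable_mul (μ := volume) hO
    (dd_smoothOn hO ((hU k).mul (hU l)) (ex l)).continuousOn
  have e1 : (fun z => comp u k z * (dd et ξ z + ∑ l, dd (ex l) (dd (ex l) ξ) z)
      + ∑ l, comp u k z * comp u l z * dd (ex l) ξ z) =
      fun z => (comp u k z * dd et ξ z + ∑ l, comp u k z * dd (ex l) (dd (ex l) ξ) z)
      + ∑ l, comp u k z * comp u l z * dd (ex l) ξ z := by
    funext z; rw [mul_add, Finset.mul_sum]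
  have e2 : (fun z => force u k z * ξ z) = fun z => (dd et (comp u k) z * ξ z
      - ∑ l, dd (ex l) (dd (ex l) (comp u k)) z * ξ z)
      + ∑ l, dd (ex l) (fun y => comp u k y * comp u l y) z * ξ z := by
    funext z; rw [force, add_mul, sub_mul, Finset.sum_mul, Finset.sum_mul]
  have k2 := integrable_finsetSum Finset.univ fun l _ => i2 l
  have k3 := integrable_finsetSum Finset.univ fun l _ => i3 l
  have l2 := integrable_finsetSum Finset.univ fun l _ => j2 l
  have l3 := integrable_finsetSum Finset.univ fun l _ => j3 l
  have k12 := i1.fun_add k2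
  have l12 : Integrable (fun z => dd et (comp u k) z * ξ z
      - ∑ l, dd (ex l) (dd (ex l) (comp u k)) z * ξ z) := j1.sub l2
  rw [e1, e2]
  refine ⟨k12.add k3, ?_⟩
  rw [integral_add k12 k3, integral_add i1 k2, integral_add l12 l3,
    integral_sub j1 l2, integral_finsetSum _ fun l _ => i2 l,
    integral_finsetSum _ fun l _ => i3 l, integral_finsetSum _ fun l _ => j2 l,
    integral_finsetSum _ fun l _ => j3 l, hξ.integral_mul_dd hO (hU k)]
  have m2 : ∀ l, ∫ z, comp u k z * dd (ex l) (dd (ex l) ξ) z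
      = ∫ z, dd (ex l) (dd (ex l) (comp u k)) z * ξ z := by
    intro l
    rw [(hξ.dd (ex l)).integral_mul_dd hO (hU k), hξ.integral_mul_dd hO
      (dd_smoothOn hO (hU k) _), neg_neg]
  have m3 : ∀ l, ∫ z, comp u k z * comp u l z * dd (ex l) ξ z
      = - ∫ z, dd (ex l) (fun y => comp u k y * comp u l y) z * ξ z :=
    fun l => hξ.integral_mul_dd hO ((hU k).mul (hU l)) _
  simp only [m2, m3, Finset.sum_neg_distrib]
  ring

/-- Testing the momentum equation with a divergence-free field removes the pressure. -/
theorem integral_force_mul_eq_zero (h : IsLocalLerayWith u₀ u G p) (hu : IsRegularOn u T)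
    {ζ : ℝ × E3 → E3} (hζ : ContDiff ℝ ∞ ζ) (hb : ∀ k, IsBump (slab T) fun z => ζ z k)
    (hc : HasCompactSupport ζ) (hs : tsupport ζ ⊆ slab T)
    (hdiv : ∀ z, ∑ j, dd (ex j) (fun y => ζ y j) z = 0) :
    ∑ k, ∫ z, force u k z * ζ z k = 0 := by
  have h0 := h.momentum ζ ⟨hζ, hc, hs.trans (slab_subset T)⟩
  have hdiff : ∀ z, DifferentiableAt ℝ ζ z := fun z => hζ.differentiable (by simp) z
  have h1 : ∀ z : ℝ × E3, (⟪u z.1 z.2, dt ζ z + lap ζ z⟫_ℝ + ⟪u z.1 z.2, dx ζ z (u z.1 z.2)⟫_ℝ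
      + p z.1 z.2 * ∑ j, dx ζ z (e j) j) =
      ∑ k, (comp u k z * (dd et (fun y => ζ y k) z
        + ∑ l, dd (ex l) (dd (ex l) (fun y => ζ y k)) z)
      + ∑ l, comp u k z * comp u l z * dd (ex l) (fun y => ζ y k) z) := by
    intro z
    have hz : ∑ j, dx ζ z (e j) j = 0 := by
      rw [← hdiv z]
      exact Finset.sum_congr rfl fun j _ => fderiv_coord (hdiff z) _ j
    rw [hz, mul_zero, add_zero, inner_eq_sum, inner_eq_sum, ← Finset.sum_add_distrib]
    refine Finset.sum_congr rfl fun k _ => ?_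
    have a1 : dt ζ z k = dd et (fun y => ζ y k) z := fderiv_coord (hdiff z) _ k
    have a2 : dx ζ z (u z.1 z.2) k = ∑ l, comp u l z * dd (ex l) (fun y => ζ y k) z := by
      rw [dx, fderiv_coord (hdiff z)]
      exact fderiv_apply_eq_sum z _
    rw [PiLp.add_apply, a1, a2, lap_coord hζ, Finset.mul_sum]
    simp only [comp, mul_assoc]
  simp only [h1] at h0
  rw [integral_finsetSum _ fun k _ => (integral_force_mul hu k (hb k)).1] at h0
  simp only [(integral_force_mul hu _ (hb _)).2, Finset.sum_neg_distrib] at h0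
  linarith

/-- The force `∂ₜu - Δu + div (u ⊗ u)` is curl-free. -/
theorem curl_force_eq_zero (h : IsLocalLerayWith u₀ u G p) (hu : IsRegularOn u T)
    {j k : Fin 3} (hjk : j ≠ k) :
    ∀ z ∈ slab T, dd (ex j) (force u k) z - dd (ex k) (force u j) z = 0 := by
  have hO := isOpen_slab T
  have hF := force_smoothOn hu
  refine eq_zero_of_integral_mul_bump_eq_zero (μ := volume) hO
    ((dd_smoothOn hO (hF k) _).sub (dd_smoothOn hO (hF j) _)).continuousOn fun ξ hξ => ?_
  -- a divergence-free test field: up to sign, the curl of `ξ` times a basis vector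
  set ζ : ℝ × E3 → E3 := fun z => dd (ex j) ξ z • e k - dd (ex k) ξ z • e j with hζdef
  have hb1 := hξ.dd (ex j)
  have hb2 := hξ.dd (ex k)
  have hζ : ContDiff ℝ ∞ ζ :=
    (hb1.smooth.smul contDiff_const).sub (hb2.smooth.smul contDiff_const)
  have hsupp : ∀ z ∉ tsupport ξ, ζ z = 0 := by
    intro z hz
    have n1 : dd (ex j) ξ z = 0 := image_eq_zero_of_notMem_tsupport
      fun h => hz (tsupport_dd_subset _ _ h)
    have n2 : dd (ex k) ξ z = 0 := image_eq_zero_of_notMem_tsupport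
      fun h => hz (tsupport_dd_subset _ _ h)
    simp [hζdef, n1, n2]
  have hts : tsupport ζ ⊆ tsupport ξ := closure_minimal
    (fun z hz => by_contra fun hn => hz (hsupp z hn)) (isClosed_tsupport ξ)
  have hcoord : ∀ m z, ζ z m
      = (if m = k then dd (ex j) ξ z else 0) - (if m = j then dd (ex k) ξ z else 0) := by
    intro m z
    simp [hζdef, e, EuclideanSpace.single]
  have hck : (fun z => ζ z k) = dd (ex j) ξ := by
    funext z; simp [hcoord, hjk.symm]
  have hcj : (fun z => ζ z j) = fun z => - dd (ex k) ξ z := by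
    funext z; simp [hcoord, hjk]
  have hcm : ∀ m, m ≠ k → m ≠ j → (fun z => ζ z m) = fun _ => 0 := by
    intro m h1 h2; funext z; simp [hcoord, h1, h2]
  have hb : ∀ m, IsBump (slab T) fun z => ζ z m := by
    intro m
    have hm : tsupport (fun z => ζ z m) ⊆ tsupport ξ := closure_minimal
      (fun z hz => by_contra fun hn => hz (by simp [hsupp z hn])) (isClosed_tsupport ξ)
    exact ⟨coord_contDiff hζ m, hξ.compact.of_isClosed_subset (isClosed_tsupport _) hm,
      hm.trans hξ.supp⟩
  have hsum : ∀ f : Fin 3 → ℝ, (∀ m, m ≠ k → m ≠ j → f m = 0) → ∑ m, f m = f k + f j := by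
    intro f hf
    rw [← Finset.sum_subset (Finset.subset_univ {k, j}), Finset.sum_pair hjk.symm]
    intro m _ hm
    simp only [Finset.mem_insert, Finset.mem_singleton, not_or] at hm
    exact hf m hm.1 hm.2
  have key := integral_force_mul_eq_zero h hu hζ hb
    (hξ.compact.of_isClosed_subset (isClosed_tsupport _) hts) (hts.trans hξ.supp) (by
      intro z
      rw [hsum _ (fun m h1 h2 => by rw [hcm m h1 h2]; simp [dd]), hck, hcj]
      have : dd (ex j) (fun z => - dd (ex k) ξ z) z = - dd (ex j) (dd (ex k) ξ) z := by
        simp only [dd]; rw [fderiv_fun_neg]; rfl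
      rw [this, dd_comm isOpen_univ (contDiffOn_univ.2 hξ.smooth) (mem_univ z) (ex k)]
      ring)
  rw [hsum _ (fun m h1 h2 => by
    have := hcm m h1 h2
    simp [fun z => congrFun this z])] at key
  have r1 : ∀ z, ζ z k = dd (ex j) ξ z := congrFun hck
  have r2 : ∀ z, ζ z j = - dd (ex k) ξ z := congrFun hcj
  simp only [r1, r2, mul_neg, integral_neg] at key
  rw [hξ.integral_mul_dd hO (hF k), hξ.integral_mul_dd hO (hF j)] at key
  simp only [sub_mul]
  rw [integral_sub (hξ.integrable_mul hO (dd_smoothOn hO (hF k) _).continuousOn)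
    (hξ.integrable_mul hO (dd_smoothOn hO (hF j) _).continuousOn)]
  linarith

end LocalLeray

/-! ### The vorticity equation and the localized enstrophy balance -/

section Pointwise

variable {u₀ : E3 → E3} {u : ℝ → E3 → E3} {G : ℝ → E3 → (E3 →L[ℝ] E3)} {p : ℝ → E3 → ℝ} {T : ℝ}

theorem vort_smoothOn (hu : IsRegularOn u T) (k : Fin 3) :
    ContDiffOn ℝ ∞ (vort u k) (slab T) :=
  (dd_smoothOn (isOpen_slab T) (comp_smoothOn hu _) _).sub
    (dd_smoothOn (isOpen_slab T) (comp_smoothOn hu _) _)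

theorem force_eq (h : IsLocalLerayWith u₀ u G p) (hu : IsRegularOn u T) (k : Fin 3) :
    ∀ z ∈ slab T, force u k z = dd et (comp u k) z - ∑ l, dd (ex l) (dd (ex l) (comp u k)) z
      + ∑ l, comp u l z * dd (ex l) (comp u k) z := by
  intro z hz
  have hO := isOpen_slab T
  have hU := comp_smoothOn hu
  have hdiv := divergence_eq_zero h hu z hz
  have : ∑ l, dd (ex l) (fun y => comp u k y * comp u l y) z
      = ∑ l, comp u l z * dd (ex l) (comp u k) z := by
    simp only [dd_mul hO (hU k) (hU _) hz, Finset.sum_add_distrib, ← Finset.mul_sum, hdiv]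
    ring
  rw [force, this]

theorem dd_force (h : IsLocalLerayWith u₀ u G p) (hu : IsRegularOn u T) (j k : Fin 3) :
    ∀ z ∈ slab T, dd (ex j) (force u k) z = dd et (dd (ex j) (comp u k)) z
      - ∑ l, dd (ex l) (dd (ex l) (dd (ex j) (comp u k))) z
      + ∑ l, (comp u l z * dd (ex l) (dd (ex j) (comp u k)) z
        + dd (ex l) (comp u k) z * dd (ex j) (comp u l) z) := by
  intro z hz
  have hO := isOpen_slab T
  have hU := comp_smoothOn hu
  have hD := fun v k => dd_smoothOn hO (hU k) v
  have hDD := fun w v k => dd_smoothOn hO (hD v k) w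
  have hP := fun l => (hU l).mul (hD (ex l) k)
  rw [dd_congr hO (force_eq h hu k) hz,
    dd_add hO ((hD et k).sub (smoothOn_sum _ fun l _ => hDD (ex l) (ex l) k))
      (smoothOn_sum _ fun l _ => hP l) hz,
    dd_sub hO (hD et k) (smoothOn_sum _ fun l _ => hDD (ex l) (ex l) k) hz,
    dd_sum hO _ (fun l _ => hDD (ex l) (ex l) k) hz, dd_sum hO _ (fun l _ => hP l) hz,
    dd_comm hO (hU k) hz]
  congr 1
  · congr 1
    refine Finset.sum_congr rfl fun l _ => ?_
    rw [dd_comm hO (hD (ex l) k) hz]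
    exact dd_congr hO (fun y hy => dd_comm hO (hU k) hy _ _) hz
  · refine Finset.sum_congr rfl fun l _ => ?_
    rw [dd_mul hO (hU l) (hD (ex l) k) hz, dd_comm hO (hU k) hz]

/-- The vorticity equation `∂ₜω = Δω - (u·∇)ω + (ω·∇)u`, which holds pointwise where the solution
is smooth. -/
theorem vorticity_equation (h : IsLocalLerayWith u₀ u G p) (hu : IsRegularOn u T) (k : Fin 3) :
    ∀ z ∈ slab T, dd et (vort u k) z = ∑ l, dd (ex l) (dd (ex l) (vort u k)) z
      - ∑ l, comp u l z * dd (ex l) (vort u k) z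
      + ∑ j, vort u j z * dd (ex j) (comp u k) z := by
  intro z hz
  have hO := isOpen_slab T
  have hU := comp_smoothOn hu
  have hD := fun v k => dd_smoothOn hO (hU k) v
  have hDD := fun w v k => dd_smoothOn hO (hD v k) w
  have hdiv := divergence_eq_zero h hu z hz
  have hne : k + 1 ≠ k + 2 := by fin_cases k <;> decide
  have hcurl := curl_force_eq_zero h hu hne z hz
  rw [dd_force h hu _ _ z hz, dd_force h hu _ _ z hz] at hcurl
  have e1 : ∀ v, ∀ y ∈ slab T, dd v (vort u k) y = dd v (dd (ex (k + 1)) (comp u (k + 2))) y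
      - dd v (dd (ex (k + 2)) (comp u (k + 1))) y :=
    fun v y hy => dd_sub hO (hD _ _) (hD _ _) hy
  have e2 : ∀ l, dd (ex l) (dd (ex l) (vort u k)) z
      = dd (ex l) (dd (ex l) (dd (ex (k + 1)) (comp u (k + 2)))) z
      - dd (ex l) (dd (ex l) (dd (ex (k + 2)) (comp u (k + 1)))) z := by
    intro l
    rw [dd_congr hO (e1 (ex l)) hz, dd_sub hO (hDD _ _ _) (hDD _ _ _) hz]
  simp only [e1 _ z hz, e2]
  -- for divergence-free fields, the quadratic terms in `∇u` make up the vortex stretching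
  have alg : ∑ l, (dd (ex l) (comp u (k + 2)) z * dd (ex (k + 1)) (comp u l) z
      - dd (ex l) (comp u (k + 1)) z * dd (ex (k + 2)) (comp u l) z)
      = - ∑ j, vort u j z * dd (ex j) (comp u k) z := by
    simp only [vort, Fin.sum_univ_three] at hdiv ⊢
    fin_cases k <;> simp only [Fin.zero_eta, Fin.mk_one, Fin.reduceFinMk, Fin.isValue, zero_add,
      Fin.reduceAdd]
    · linear_combination (dd (ex 1) (comp u 2) z - dd (ex 2) (comp u 1) z) * hdiv
    · linear_combination (dd (ex 2) (comp u 0) z - dd (ex 0) (comp u 2) z) * hdiv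
    · linear_combination (dd (ex 0) (comp u 1) z - dd (ex 1) (comp u 0) z) * hdiv
  simp only [Finset.sum_add_distrib, Finset.sum_sub_distrib, mul_sub] at hcurl alg ⊢
  linear_combination hcurl - alg

/-- The enstrophy density `½|ω|²` on space-time. -/
noncomputable def enst (u : ℝ → E3 → E3) (z : ℝ × E3) : ℝ := 1 / 2 * ∑ k, vort u k z * vort u k z

/-- The palinstrophy density `|∇ω|²` on space-time. -/
noncomputable def palin (u : ℝ → E3 → E3) (z : ℝ × E3) : ℝ :=
  ∑ l, ∑ k, dd (ex l) (vort u k) z * dd (ex l) (vort u k) z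

/-- The vortex-stretching density `(ω·∇)u·ω` on space-time. -/
noncomputable def stretch (u : ℝ → E3 → E3) (z : ℝ × E3) : ℝ :=
  ∑ k, (∑ j, vort u j z * dd (ex j) (comp u k) z) * vort u k z

theorem enst_smoothOn (hu : IsRegularOn u T) : ContDiffOn ℝ ∞ (enst u) (slab T) :=
  contDiffOn_const.mul (smoothOn_sum _ fun k _ => (vort_smoothOn hu k).mul (vort_smoothOn hu k))

theorem palin_smoothOn (hu : IsRegularOn u T) : ContDiffOn ℝ ∞ (palin u) (slab T) :=
  smoothOn_sum _ fun _ _ => smoothOn_sum _ fun k _ =>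
    (dd_smoothOn (isOpen_slab T) (vort_smoothOn hu k) _).mul
      (dd_smoothOn (isOpen_slab T) (vort_smoothOn hu k) _)

theorem stretch_smoothOn (hu : IsRegularOn u T) : ContDiffOn ℝ ∞ (stretch u) (slab T) :=
  smoothOn_sum _ fun k _ => (smoothOn_sum _ fun j _ => (vort_smoothOn hu j).mul
    (dd_smoothOn (isOpen_slab T) (comp_smoothOn hu k) _)).mul (vort_smoothOn hu k)

theorem enst_nonneg (u : ℝ → E3 → E3) (z : ℝ × E3) : 0 ≤ enst u z :=
  mul_nonneg (by norm_num) (Finset.sum_nonneg fun _ _ => mul_self_nonneg _)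

theorem palin_nonneg (u : ℝ → E3 → E3) (z : ℝ × E3) : 0 ≤ palin u z :=
  Finset.sum_nonneg fun _ _ => Finset.sum_nonneg fun _ _ => mul_self_nonneg _

theorem dd_enst (hu : IsRegularOn u T) (v : ℝ × E3) :
    ∀ z ∈ slab T, dd v (enst u) z = ∑ k, vort u k z * dd v (vort u k) z := by
  intro z hz
  have hO := isOpen_slab T
  have hW := vort_smoothOn hu
  have := dd_const_mul (v := v) hO (smoothOn_sum Finset.univ fun k _ => (hW k).mul (hW k))
    (1 / 2) hz
  refine this.trans ?_
  rw [dd_sum hO _ (fun k _ => (hW k).mul (hW k)) hz, Finset.mul_sum]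
  refine Finset.sum_congr rfl fun k _ => ?_
  rw [dd_mul hO (hW k) (hW k) hz]
  ring

/-- The local enstrophy balance `∂ₜh = Δh - u·∇h - |∇ω|² + (ω·∇)u·ω` for `h = ½|ω|²`. -/
theorem enstrophy_balance (h : IsLocalLerayWith u₀ u G p) (hu : IsRegularOn u T) :
    ∀ z ∈ slab T, dd et (enst u) z = ∑ l, dd (ex l) (dd (ex l) (enst u)) z
      - ∑ l, comp u l z * dd (ex l) (enst u) z - palin u z + stretch u z := by
  intro z hz
  have hO := isOpen_slab T
  have hW := vort_smoothOn hu
  have hDW := fun v k => dd_smoothOn hO (hW k) v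
  have e2 : ∀ l, dd (ex l) (dd (ex l) (enst u)) z = ∑ k, (vort u k z
      * dd (ex l) (dd (ex l) (vort u k)) z
      + dd (ex l) (vort u k) z * dd (ex l) (vort u k) z) := by
    intro l
    rw [dd_congr hO (dd_enst hu (ex l)) hz,
      dd_sum hO _ (fun k _ => (hW k).mul (hDW (ex l) k)) hz]
    exact Finset.sum_congr rfl fun k _ => dd_mul hO (hW k) (hDW (ex l) k) hz
  simp only [e2, dd_enst hu _ z hz, vorticity_equation h hu _ z hz, palin, stretch,
    Finset.sum_add_distrib]
  simp only [Fin.sum_univ_three]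
  ring

end Pointwise

section Integrals

variable {u₀ : E3 → E3} {u : ℝ → E3 → E3} {G : ℝ → E3 → (E3 →L[ℝ] E3)} {p : ℝ → E3 → ℝ} {T : ℝ}
  {f : ℝ × E3 → ℝ} {Ψ : E3 → ℝ}

/-- The spatial integral of `f` at time `s` with weight `Ψ`. -/
noncomputable def spaceInt (f : ℝ × E3 → ℝ) (Ψ : E3 → ℝ) (s : ℝ) : ℝ := ∫ x, f (s, x) * Ψ x

theorem continuous_slice (hf : ContinuousOn f (slab T)) {s : ℝ} (hs : s ∈ Ioo 0 T) :
    Continuous fun x => f (s, x) :=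
  continuousOn_univ.1 (hf.comp (by fun_prop) fun x _ => mem_slab hs x)

theorem smooth_slice {F : Type*} [NormedAddCommGroup F] [NormedSpace ℝ F] {f : ℝ × E3 → F}
    (hf : ContDiffOn ℝ ∞ f (slab T)) {s : ℝ} (hs : s ∈ Ioo 0 T) :
    ContDiff ℝ ∞ fun x => f (s, x) :=
  contDiffOn_univ.1 (hf.comp (contDiff_prodMk_right s).contDiffOn fun x _ => mem_slab hs x)

theorem integrable_slice_mul (hf : ContinuousOn f (slab T)) (hΨ : Continuous Ψ)
    (hc : HasCompactSupport Ψ) {s : ℝ} (hs : s ∈ Ioo 0 T) :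
    Integrable fun x => f (s, x) * Ψ x :=
  ((continuous_slice hf hs).mul hΨ).integrable_of_hasCompactSupport hc.mul_left

theorem spaceInt_continuousOn (hf : ContinuousOn f (slab T)) (hΨ : Continuous Ψ)
    (hc : HasCompactSupport Ψ) : ContinuousOn (spaceInt f Ψ) (Ioo 0 T) := by
  refine continuousOn_integral_of_compact_support (f := fun s x => f (s, x) * Ψ x) hc
    (hf.mul (hΨ.comp continuous_snd).continuousOn) fun s x _ hx => ?_
  rw [image_eq_zero_of_notMem_tsupport hx, mul_zero]

theorem hasDerivAt_time (hf : ContDiffOn ℝ ∞ f (slab T)) {s : ℝ} (hs : s ∈ Ioo 0 T) (x : E3) :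
    HasDerivAt (fun r => f (r, x)) (dd et f (s, x)) s := by
  have h1 := (differentiableAt_of_smoothOn (isOpen_slab T) hf (mem_slab hs x)).hasFDerivAt
  exact h1.comp_hasDerivAt s ((hasDerivAt_id s).prodMk (hasDerivAt_const s x))

theorem spaceInt_hasDerivAt (hf : ContDiffOn ℝ ∞ f (slab T)) (hΨ : Continuous Ψ)
    (hc : HasCompactSupport Ψ) {s : ℝ} (hs : s ∈ Ioo 0 T) :
    HasDerivAt (spaceInt f Ψ) (spaceInt (dd et f) Ψ s) s := by
  have hdf := (dd_smoothOn (isOpen_slab T) hf et).continuousOn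
  obtain ⟨ε, hε, hball⟩ := Metric.isOpen_iff.1 isOpen_Ioo s hs
  have hsub : closedBall s (ε / 2) ⊆ Ioo 0 T :=
    (closedBall_subset_ball (by linarith)).trans hball
  have hK : IsCompact (closedBall s (ε / 2) ×ˢ tsupport Ψ) := (isCompact_closedBall _ _).prod hc
  obtain ⟨C, hC⟩ := hK.exists_bound_of_continuousOn
    (f := fun z : ℝ × E3 => dd et f z) (hdf.mono (prod_mono hsub (subset_univ _)))
  refine (hasDerivAt_integral_of_dominated_loc_of_deriv_le (F := fun r x => f (r, x) * Ψ x)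
    (F' := fun r x => dd et f (r, x) * Ψ x) (bound := fun x => C * ‖Ψ x‖)
    (closedBall_mem_nhds s (by linarith : 0 < ε / 2)) ?_ ?_ ?_ ?_ ?_ ?_).2
  · filter_upwards [isOpen_Ioo.mem_nhds hs] with r hr
    exact (integrable_slice_mul hf.continuousOn hΨ hc hr).aestronglyMeasurable
  · exact integrable_slice_mul hf.continuousOn hΨ hc hs
  · exact (integrable_slice_mul hdf hΨ hc hs).aestronglyMeasurable
  · refine Eventually.of_forall fun x r hr => ?_
    by_cases hx : x ∈ tsupport Ψ
    · rw [norm_mul]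
      exact mul_le_mul_of_nonneg_right (hC (r, x) ⟨hr, hx⟩) (norm_nonneg _)
    · simp [image_eq_zero_of_notMem_tsupport hx]
  · exact (hΨ.norm.integrable_of_hasCompactSupport hc.norm).const_mul C
  · exact Eventually.of_forall fun x r hr => (hasDerivAt_time hf (hsub hr) x).mul_const _

theorem spaceInt_dd (hf : ContDiffOn ℝ ∞ f (slab T)) (hΨ : IsBump univ Ψ) {s : ℝ}
    (hs : s ∈ Ioo 0 T) (l : Fin 3) :
    spaceInt (dd (ex l) f) Ψ s = - spaceInt f (dd (e l) Ψ) s := by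
  have hsl := smooth_slice hf hs
  have h := hΨ.integral_mul_dd (μ := volume) isOpen_univ (contDiffOn_univ.2 hsl) (e l)
  rw [spaceInt, spaceInt, h, neg_neg]
  congr 1
  funext x
  rw [dd_slice (differentiableAt_of_smoothOn (isOpen_slab T) hf (mem_slab hs x))]

/-- The rate of change of the localized enstrophy, after integrating by parts in space. -/
theorem spaceInt_dt_enst (h : IsLocalLerayWith u₀ u G p) (hu : IsRegularOn u T)
    (hΨ : IsBump univ Ψ) {s : ℝ} (hs : s ∈ Ioo 0 T) :
    spaceInt (dd et (enst u)) Ψ s = spaceInt (enst u) (Δ Ψ) s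
      + ∑ l, spaceInt (fun z => comp u l z * enst u z) (dd (e l) Ψ) s
      - spaceInt (palin u) Ψ s + spaceInt (stretch u) Ψ s := by
  have hO := isOpen_slab T
  have hE := enst_smoothOn hu
  have hU := comp_smoothOn hu
  have hc := hΨ.compact
  have hcont := hΨ.smooth.continuous
  have hDE := fun l => dd_smoothOn hO hE (ex l)
  have hDDE := fun l => dd_smoothOn hO (hDE l) (ex l)
  have hUE := fun l => (hU l).mul hE
  have hDUE := fun l => dd_smoothOn hO (hUE l) (ex l)
  have i1 := fun l => integrable_slice_mul (hDDE l).continuousOn hcont hc hs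
  have i2 := fun l => integrable_slice_mul (hDUE l).continuousOn hcont hc hs
  have i3 := integrable_slice_mul (palin_smoothOn hu).continuousOn hcont hc hs
  have i4 := integrable_slice_mul (stretch_smoothOn hu).continuousOn hcont hc hs
  have key : ∀ x, dd et (enst u) (s, x) * Ψ x = ∑ l, dd (ex l) (dd (ex l) (enst u)) (s, x) * Ψ x
      - ∑ l, dd (ex l) (fun z => comp u l z * enst u z) (s, x) * Ψ x
      - palin u (s, x) * Ψ x + stretch u (s, x) * Ψ x := by
    intro x
    have hz := mem_slab hs x
    have hd := divergence_eq_zero h hu _ hz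
    simp only [enstrophy_balance h hu _ hz, dd_mul hO (hU _) hE hz]
    simp only [Fin.sum_univ_three] at hd ⊢
    linear_combination (enst u (s, x) * Ψ x) * hd
  have hlap : ∀ x, enst u (s, x) * Δ Ψ x = ∑ l, enst u (s, x) * dd (e l) (dd (e l) Ψ) x := by
    intro x
    rw [laplacian_eq_sum_dd hΨ.smooth, Finset.mul_sum]
  have j1 := fun l => integrable_slice_mul hE.continuousOn
    ((hΨ.dd (e l)).dd (e l)).smooth.continuous ((hΨ.dd (e l)).dd (e l)).compact hs
  have k1 := integrable_finsetSum Finset.univ fun l _ => i1 l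
  have k2 := integrable_finsetSum Finset.univ fun l _ => i2 l
  have k12 : Integrable fun x => ∑ l, dd (ex l) (dd (ex l) (enst u)) (s, x) * Ψ x
      - ∑ l, dd (ex l) (fun z => comp u l z * enst u z) (s, x) * Ψ x := k1.sub k2
  have k123 : Integrable fun x => ∑ l, dd (ex l) (dd (ex l) (enst u)) (s, x) * Ψ x
      - ∑ l, dd (ex l) (fun z => comp u l z * enst u z) (s, x) * Ψ x - palin u (s, x) * Ψ x :=
    k12.sub i3
  have m1 : ∀ l, ∫ x, dd (ex l) (dd (ex l) (enst u)) (s, x) * Ψ x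
      = ∫ x, enst u (s, x) * dd (e l) (dd (e l) Ψ) x := by
    intro l
    have a := spaceInt_dd (hDE l) hΨ hs l
    have b := spaceInt_dd hE (hΨ.dd (e l)) hs l
    simp only [spaceInt] at a b
    rw [a, b, neg_neg]
  have m2 : ∀ l, ∫ x, dd (ex l) (fun z => comp u l z * enst u z) (s, x) * Ψ x
      = - spaceInt (fun z => comp u l z * enst u z) (dd (e l) Ψ) s :=
    fun l => spaceInt_dd (hUE l) hΨ hs l
  simp only [spaceInt, key, hlap] at m2 ⊢
  rw [integral_add k123 i4, integral_sub k12 i3, integral_sub k1 k2,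
    integral_finsetSum _ fun l _ => i1 l, integral_finsetSum _ fun l _ => i2 l,
    integral_finsetSum _ fun l _ => j1 l]
  simp only [m1, m2, Finset.sum_neg_distrib]
  ring

end Integrals

section Time

variable {T t : ℝ}

/-- A function that vanishes near the initial time is integrable up to it, even though it is only
continuous on the open interval. -/
theorem intervalIntegrable_of_eq_zero {f : ℝ → ℝ} (hf : ContinuousOn f (Ioo 0 T))
    (h0 : ∀ s ∈ Ioo 0 (T / 3), f s = 0) (ht : t ∈ Ioo (2 * T / 3) T) :
    IntervalIntegrable f volume 0 t ∧ ∫ s in 0..t, f s = ∫ s in (T / 6)..t, f s := by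
  have hT : 0 < T := by have := ht.1.trans ht.2; linarith
  have h1 : EqOn (fun _ => (0 : ℝ)) f (uIoc 0 (T / 6)) := by
    intro s hs
    rw [uIoc_of_le (by linarith)] at hs
    exact (h0 s ⟨hs.1, by linarith [hs.2]⟩).symm
  have i1 : IntervalIntegrable f volume 0 (T / 6) :=
    (intervalIntegrable_const (c := (0 : ℝ))).congr h1
  have i2 : IntervalIntegrable f volume (T / 6) t := by
    refine (hf.mono ?_).intervalIntegrable
    rw [uIcc_of_le (by linarith [ht.1])]
    exact fun s hs => ⟨by linarith [hs.1], hs.2.trans_lt ht.2⟩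
  refine ⟨i1.trans i2, ?_⟩
  rw [← intervalIntegral.integral_add_adjacent_intervals i1 i2]
  have : ∫ s in 0..(T / 6), f s = ∫ s in 0..(T / 6), (0 : ℝ) :=
    intervalIntegral.integral_congr_ae (Eventually.of_forall fun s hs => (h1 hs).symm)
  rw [this]
  simp

/-- The localized enstrophy balance, integrated over `(0,t)` against a temporal cut-off. -/
theorem intervalIntegral_enstrophy_balance {u₀ : E3 → E3} {u : ℝ → E3 → E3}
    {G : ℝ → E3 → (E3 →L[ℝ] E3)} {p : ℝ → E3 → ℝ} {Ψ : E3 → ℝ} {η : ℝ → ℝ}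
    (h : IsLocalLerayWith u₀ u G p) (hu : IsRegularOn u T) (hΨ : IsBump univ Ψ)
    (hη : ContDiffOn ℝ ∞ η (Ioo 0 T)) (h0 : ∀ s ∈ Ioo 0 (T / 3), η s = 0)
    (ht : t ∈ Ioo (2 * T / 3) T) (h1 : η t = 1) :
    ∫ s in 0..t, η s * spaceInt (stretch u) Ψ s = spaceInt (enst u) Ψ t
      + (∫ s in 0..t, η s * spaceInt (palin u) Ψ s)
      - ∫ s in 0..t, (deriv η s * spaceInt (enst u) Ψ s + η s * spaceInt (enst u) (Δ Ψ) s
        + η s * ∑ l, spaceInt (fun z => comp u l z * enst u z) (dd (e l) Ψ) s) := by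
  have hT : 0 < T := by have := ht.1.trans ht.2; linarith
  have hE := enst_smoothOn hu
  have hc := hΨ.compact
  have hcont := hΨ.smooth.continuous
  have hlap : (Δ Ψ) = fun x => ∑ l, dd (e l) (dd (e l) Ψ) x :=
    funext fun x => laplacian_eq_sum_dd hΨ.smooth x
  have hlapc : Continuous (Δ Ψ) := by
    rw [hlap]
    exact continuous_finsetSum _ fun l _ => ((hΨ.dd (e l)).dd (e l)).smooth.continuous
  have hlaps : HasCompactSupport (Δ Ψ) := by
    refine hc.of_isClosed_subset (isClosed_tsupport _) (closure_minimal ?_ (isClosed_tsupport Ψ))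
    intro x hx
    by_contra hn
    refine hx ?_
    rw [hlap]
    exact Finset.sum_eq_zero fun l _ => image_eq_zero_of_notMem_tsupport
      fun hm => hn (tsupport_dd_subset _ _ (tsupport_dd_subset _ _ hm))
  have hηc := hη.continuousOn
  have hη' : ContinuousOn (deriv η) (Ioo 0 T) := 
    hη.continuousOn_deriv_of_isOpen isOpen_Ioo (by simp)
  have hη'0 : ∀ s ∈ Ioo 0 (T / 3), deriv η s = 0 := by
    intro s hs
    rw [Filter.EventuallyEq.deriv_eq (f := fun _ => (0 : ℝ))
      (Filter.eventually_of_mem (isOpen_Ioo.mem_nhds hs) h0)]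
    simp
  have c1 := spaceInt_continuousOn (stretch_smoothOn hu).continuousOn hcont hc
  have c2 := spaceInt_continuousOn (palin_smoothOn hu).continuousOn hcont hc
  have c3 := spaceInt_continuousOn hE.continuousOn hcont hc
  have c4 := spaceInt_continuousOn hE.continuousOn hlapc hlaps
  have c5 : ContinuousOn (fun s => ∑ l, spaceInt (fun z => comp u l z * enst u z) (dd (e l) Ψ) s)
      (Ioo 0 T) := continuousOn_finsetSum _ fun l _ =>
    spaceInt_continuousOn ((comp_smoothOn hu l).mul hE).continuousOn (hΨ.dd (e l)).smooth.continuous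
      (hΨ.dd (e l)).compact
  obtain ⟨i1, -⟩ := intervalIntegrable_of_eq_zero (hηc.mul c1)
    (fun s hs => by simp [h0 s hs]) ht
  obtain ⟨i2, -⟩ := intervalIntegrable_of_eq_zero (hηc.mul c2)
    (fun s hs => by simp [h0 s hs]) ht
  obtain ⟨i3, -⟩ := intervalIntegrable_of_eq_zero (((hη'.mul c3).add (hηc.mul c4)).add
    (hηc.mul c5)) (fun s hs => by simp [h0 s hs, hη'0 s hs]) ht
  have cL := ((hηc.mul c1).sub (hηc.mul c2)).add (((hη'.mul c3).add (hηc.mul c4)).add (hηc.mul c5))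
  obtain ⟨i4, e4⟩ := intervalIntegrable_of_eq_zero cL
    (fun s hs => by simp [h0 s hs, hη'0 s hs]) ht
  have hsub : ∀ s ∈ uIcc (T / 6) t, s ∈ Ioo 0 T := by
    intro s hs
    rw [uIcc_of_le (by linarith [ht.1])] at hs
    exact ⟨by linarith [hs.1], hs.2.trans_lt ht.2⟩
  have hder : ∀ s ∈ uIcc (T / 6) t, HasDerivAt (fun s => η s * spaceInt (enst u) Ψ s)
      ((η s * spaceInt (stretch u) Ψ s - η s * spaceInt (palin u) Ψ s)
        + (deriv η s * spaceInt (enst u) Ψ s + η s * spaceInt (enst u) (Δ Ψ) s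
        + η s * ∑ l, spaceInt (fun z => comp u l z * enst u z) (dd (e l) Ψ) s)) s := by
    intro s hs
    have hs' := hsub s hs
    have d1 := ((hη.contDiffAt (isOpen_Ioo.mem_nhds hs')).differentiableAt (by simp)).hasDerivAt
    have d2 := spaceInt_hasDerivAt hE hcont hc hs'
    refine (d1.mul d2).congr_deriv ?_
    rw [spaceInt_dt_enst h hu hΨ hs']
    ring
  have ftc := intervalIntegral.integral_eq_sub_of_hasDerivAt hder
    ((cL.mono fun s hs => hsub s hs).intervalIntegrable)
  rw [h1, h0 (T / 6) ⟨by linarith, by linarith⟩] at ftc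
  have e5 : ∫ s in 0..t, ((η s * spaceInt (stretch u) Ψ s - η s * spaceInt (palin u) Ψ s)
        + (deriv η s * spaceInt (enst u) Ψ s + η s * spaceInt (enst u) (Δ Ψ) s
        + η s * ∑ l, spaceInt (fun z => comp u l z * enst u z) (dd (e l) Ψ) s))
        = spaceInt (enst u) Ψ t := by
    refine e4.trans (ftc.trans ?_)
    ring
  have e6 := ((intervalIntegral.integral_add (i1.sub i2) i3).trans
    (congrArg (· + _) (intervalIntegral.integral_sub i1 i2))).symm.trans e5
  simp only [Pi.mul_apply, Pi.add_apply] at e6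
  linarith

end Time

/-! ### The Sobolev estimate of the transport term -/

theorem memLp_of_continuous_of_hasCompactSupport {F : Type*} [NormedAddCommGroup F]
    {f : E3 → F} (hf : Continuous f) (hc : HasCompactSupport f) (q : ℝ≥0∞) :
    MemLp f q (volume : Measure E3) := hf.memLp_of_hasCompactSupport hc

/-- `c` is a constant in the Sobolev inequality `‖v‖₆ ≲ ‖∇v‖₂` for vector fields on `ℝ³`, in terms
of integrals. It enters as a fourth power for use in `sqrt_sqrt_mul_sqrt_le`. -/
def IsSobolevConst (c : ℝ) : Prop :=
  ∀ v : E3 → E3, ContDiff ℝ 1 v → HasCompactSupport v →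
    ∫ x, ‖v x‖ ^ 6 ≤ c ^ 4 * (∫ x, ‖fderiv ℝ v x‖ ^ 2) ^ 3

theorem exists_isSobolevConst : ∃ c : ℝ, 0 < c ∧ IsSobolevConst c := by
  set K : ℝ≥0 := eLpNormLESNormFDerivOfEqInnerConst (volume : Measure E3) ((2 : ℝ≥0) : ℝ) with hK
  refine ⟨(max 1 (K : ℝ)) ^ 2, by positivity, fun v hv hc => ?_⟩
  have h := eLpNorm_le_eLpNorm_fderiv_of_eq_inner (volume : Measure E3) hv hc (p := 2) (p' := 6)
    (by norm_num) (by simp) (by simp; norm_num)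
  have hdv : Continuous (fderiv ℝ v) := hv.continuous_fderiv (by simp)
  have m1 := memLp_of_continuous_of_hasCompactSupport hv.continuous hc ((6 : ℝ≥0) : ℝ≥0∞)
  have m2 := memLp_of_continuous_of_hasCompactSupport hdv (hc.fderiv ℝ) ((2 : ℝ≥0) : ℝ≥0∞)
  rw [m1.eLpNorm_eq_integral_rpow_norm (by norm_num) (by simp),
    m2.eLpNorm_eq_integral_rpow_norm (by norm_num) (by simp), ← hK,
    ← ENNReal.ofReal_coe_nnreal (p := K), ← ENNReal.ofReal_mul (by positivity)] at h
  have n1 : ∀ x, ‖v x‖ ^ (6 : ℝ) = ‖v x‖ ^ (6 : ℕ) := fun x => by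
    exact_mod_cast Real.rpow_natCast ‖v x‖ 6
  have n2 : ∀ x, ‖fderiv ℝ v x‖ ^ (2 : ℝ) = ‖fderiv ℝ v x‖ ^ (2 : ℕ) := fun x => by
    exact_mod_cast Real.rpow_natCast ‖fderiv ℝ v x‖ 2
  simp only [ENNReal.coe_toReal, NNReal.coe_ofNat, n1, n2] at h
  set S := ∫ x, ‖v x‖ ^ 6
  set D := ∫ x, ‖fderiv ℝ v x‖ ^ 2
  have hS : 0 ≤ S := integral_nonneg fun x => by positivity
  have hD : 0 ≤ D := integral_nonneg fun x => by positivity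
  have h' := (ENNReal.ofReal_le_ofReal_iff (by positivity)).1 h
  have h6 := pow_le_pow_left₀ (by positivity) h' 6
  have e1 : (S ^ (6 : ℝ)⁻¹) ^ 6 = S := by
    rw [← Real.rpow_natCast, ← Real.rpow_mul hS]; norm_num
  have e2 : (D ^ (2 : ℝ)⁻¹) ^ 6 = D ^ 3 := by
    rw [← Real.rpow_natCast, ← Real.rpow_mul hD, ← Real.rpow_natCast]; norm_num
  rw [mul_pow, e1, e2] at h6
  refine h6.trans (mul_le_mul_of_nonneg_right ?_ (by positivity))
  have hm : (1 : ℝ) ≤ max 1 (K : ℝ) := le_max_left _ _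
  calc (K : ℝ) ^ 6 ≤ (max 1 (K : ℝ)) ^ 6 := pow_le_pow_left₀ K.2 (le_max_right _ _) 6
    _ ≤ (max 1 (K : ℝ)) ^ 8 := pow_le_pow_right₀ hm (by norm_num)
    _ = ((max 1 (K : ℝ)) ^ 2) ^ 4 := by ring

theorem norm_sq_le_frobSq (A : E3 →L[ℝ] E3) : ‖A‖ ^ 2 ≤ frobSq A := by
  have hF : 0 ≤ frobSq A := Finset.sum_nonneg fun _ _ => by positivity
  rw [← Real.le_sqrt (norm_nonneg _) hF]
  refine A.opNorm_le_bound (Real.sqrt_nonneg _) fun v => ?_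
  have h1 : A v = ∑ l, v l • A (e l) := by
    conv_lhs => rw [sum_coord_smul_e v]
    simp
  have h2 : ‖A v‖ ≤ ∑ l, ‖A (e l)‖ * ‖v l‖ := by
    rw [h1]
    refine (norm_sum_le _ _).trans (le_of_eq (Finset.sum_congr rfl fun l _ => ?_))
    rw [norm_smul, mul_comm]
  refine h2.trans ((Real.sum_mul_le_sqrt_mul_sqrt _ _ _).trans (le_of_eq ?_))
  rw [EuclideanSpace.norm_eq v]
  rfl

theorem frobSq_nonneg (A : E3 →L[ℝ] E3) : 0 ≤ frobSq A :=
  Finset.sum_nonneg fun _ _ => by positivity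

theorem continuous_frobSq : Continuous frobSq := by
  unfold frobSq
  fun_prop

section Weighted

variable {ψ q : E3 → ℝ} {W V : E3 → E3} {A : ℝ}

/-- The eighth-root weight `q = ψ^{1/8}` of a cut-off `ψ` with `|∇ψ| ≤ A ψ^{7/8}`. -/
structure IsEighthRoot (A : ℝ) (ψ q : E3 → ℝ) : Prop where
  smooth : ContDiff ℝ ∞ ψ
  compact : HasCompactSupport ψ
  cont : Continuous q
  nonneg : ∀ x, 0 ≤ q x
  le_one : ∀ x, q x ≤ 1
  pow_eight : ∀ x, q x ^ 8 = ψ x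
  grad_le : ∀ x, ‖fderiv ℝ ψ x‖ ≤ A * q x ^ 7

theorem IsEighthRoot.hasCompactSupport (h : IsEighthRoot A ψ q) : HasCompactSupport q :=
  h.compact.mono fun x hx => by
    rw [Function.mem_support] at hx ⊢
    rw [← h.pow_eight]
    exact pow_ne_zero _ hx

/-- The Sobolev inequality for `√(ψ + ε) - √ε` times a vector field: the constant does not depend
on `ε`. -/
theorem IsEighthRoot.integral_regularized_le (h : IsEighthRoot A ψ q) {c : ℝ}
    (hc : IsSobolevConst c)
    (hW : ContDiff ℝ ∞ W) {ε : ℝ} (hε : 0 < ε) :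
    ∫ x, ((√(ψ x + ε) - √ε) * ‖W x‖) ^ 6 ≤ c ^ 4 * (2 * (∫ x, frobSq (fderiv ℝ W x) * q x ^ 8)
      + A ^ 2 / 2 * ∫ x, ‖W x‖ ^ 2 * q x ^ 4) ^ 3 := by
  have hψ0 : ∀ x, 0 ≤ ψ x := fun x => by rw [← h.pow_eight]; have := h.nonneg x; positivity
  set χ : E3 → ℝ := fun x => √(ψ x + ε) - √ε with hχ
  have hpos : ∀ x, 0 < ψ x + ε := fun x => by linarith [hψ0 x]
  have hχs : ContDiff ℝ 1 χ :=
    (((h.smooth.of_le (by simp)).add contDiff_const).sqrt fun x => (hpos x).ne').sub contDiff_const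
  have hχ0 : ∀ x, 0 ≤ χ x := fun x => sub_nonneg.2 (Real.sqrt_le_sqrt (by linarith [hψ0 x]))
  have hχc : HasCompactSupport χ := h.compact.mono fun x hx => by
    rw [Function.mem_support] at hx ⊢
    contrapose! hx
    simp [hχ, hx]
  have hχle : ∀ x, χ x ^ 2 ≤ q x ^ 8 := by
    intro x
    rw [h.pow_eight]
    have h1 := Real.sq_sqrt (hpos x).le
    have h2 := Real.sq_sqrt hε.le
    have h3 := Real.sqrt_nonneg ε
    have h4 := hχ0 x
    simp only [hχ] at h4 ⊢
    nlinarith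
  have hgrad : ∀ x, ‖fderiv ℝ χ x‖ ^ 2 ≤ A ^ 2 / 4 * q x ^ 4 := by
    intro x
    have hd : HasFDerivAt χ ((1 / (2 * √(ψ x + ε))) • fderiv ℝ ψ x) x := by
      have h1 := ((h.smooth.differentiable (by simp) x).hasFDerivAt.add_const ε).sqrt (hpos x).ne'
      exact h1.sub_const _
    rw [hd.fderiv, norm_smul, mul_pow, Real.norm_eq_abs, sq_abs, div_pow, mul_pow,
      Real.sq_sqrt (hpos x).le]
    have h1 : ‖fderiv ℝ ψ x‖ ^ 2 ≤ A ^ 2 * q x ^ 14 := by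
      have := pow_le_pow_left₀ (norm_nonneg _) (h.grad_le x) 2
      nlinarith
    have h2 : q x ^ 14 ≤ (ψ x + ε) * q x ^ 4 := by
      have hq := h.nonneg x
      have : q x ^ 14 ≤ q x ^ 12 := pow_le_pow_of_le_one hq (h.le_one x) (by norm_num)
      calc q x ^ 14 ≤ q x ^ 8 * q x ^ 4 := by rw [← pow_add]; exact this
        _ ≤ (ψ x + ε) * q x ^ 4 := by
          rw [h.pow_eight]
          exact mul_le_mul_of_nonneg_right (by linarith) (by positivity)
    have h3 : ‖fderiv ℝ ψ x‖ ^ 2 ≤ A ^ 2 * ((ψ x + ε) * q x ^ 4) :=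
      h1.trans (mul_le_mul_of_nonneg_left h2 (sq_nonneg A))
    calc 1 ^ 2 / (2 ^ 2 * (ψ x + ε)) * ‖fderiv ℝ ψ x‖ ^ 2
        ≤ 1 ^ 2 / (2 ^ 2 * (ψ x + ε)) * (A ^ 2 * ((ψ x + ε) * q x ^ 4)) :=
          mul_le_mul_of_nonneg_left h3 (by have := hpos x; positivity)
      _ = A ^ 2 / 4 * q x ^ 4 := by have := (hpos x).ne'; field_simp; ring
  have hW1 : ContDiff ℝ 1 W := hW.of_le (by simp)
  have hv : ContDiff ℝ 1 fun x => χ x • W x := hχs.smul hW1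
  have hvc : HasCompactSupport fun x => χ x • W x := hχc.smul_right
  have key := hc _ hv hvc
  have hdW : Continuous (fderiv ℝ W) := hW1.continuous_fderiv (by simp)
  have hfd : ∀ x, ‖fderiv ℝ (fun x => χ x • W x) x‖ ^ 2
      ≤ 2 * (frobSq (fderiv ℝ W x) * q x ^ 8) + A ^ 2 / 2 * (‖W x‖ ^ 2 * q x ^ 4) := by
    intro x
    have h1 : fderiv ℝ (fun x => χ x • W x) x
        = χ x • fderiv ℝ W x + (fderiv ℝ χ x).smulRight (W x) :=
      fderiv_fun_smul (hχs.differentiable (by simp) x) (hW1.differentiable (by simp) x)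
    have h2 : ‖fderiv ℝ (fun x => χ x • W x) x‖
        ≤ χ x * ‖fderiv ℝ W x‖ + ‖fderiv ℝ χ x‖ * ‖W x‖ := by
      rw [h1]
      refine (norm_add_le _ _).trans (add_le_add ?_ ?_)
      · rw [norm_smul, Real.norm_of_nonneg (hχ0 x)]
      · rw [ContinuousLinearMap.norm_smulRight_apply]
    have h3 := pow_le_pow_left₀ (norm_nonneg _) h2 2
    have h4 : (χ x * ‖fderiv ℝ W x‖) ^ 2 ≤ frobSq (fderiv ℝ W x) * q x ^ 8 := by
      rw [mul_pow, mul_comm]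
      exact mul_le_mul (norm_sq_le_frobSq _) (hχle x) (by positivity) (frobSq_nonneg _)
    have h5 : (‖fderiv ℝ χ x‖ * ‖W x‖) ^ 2 ≤ A ^ 2 / 4 * (‖W x‖ ^ 2 * q x ^ 4) := by
      rw [mul_pow]
      calc _ ≤ A ^ 2 / 4 * q x ^ 4 * ‖W x‖ ^ 2 :=
            mul_le_mul_of_nonneg_right (hgrad x) (by positivity)
        _ = _ := by ring
    nlinarith [sq_nonneg (χ x * ‖fderiv ℝ W x‖ - ‖fderiv ℝ χ x‖ * ‖W x‖)]
  have qc := h.hasCompactSupport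
  have qpow : ∀ n, n ≠ 0 → HasCompactSupport fun x => q x ^ n := fun n hn =>
    qc.mono fun x hx => by
      rw [Function.mem_support] at hx ⊢
      contrapose! hx
      simp [hx, hn]
  have i1 : Integrable fun x => frobSq (fderiv ℝ W x) * q x ^ 8 :=
    ((continuous_frobSq.comp hdW).mul (h.cont.pow 8)).integrable_of_hasCompactSupport
      (qpow 8 (by norm_num)).mul_left
  have i2 : Integrable fun x => ‖W x‖ ^ 2 * q x ^ 4 :=
    ((hW.continuous.norm.pow 2).mul (h.cont.pow 4)).integrable_of_hasCompactSupport
      (qpow 4 (by norm_num)).mul_left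
  have hint : ∫ x, ‖fderiv ℝ (fun x => χ x • W x) x‖ ^ 2
      ≤ 2 * (∫ x, frobSq (fderiv ℝ W x) * q x ^ 8)
      + A ^ 2 / 2 * ∫ x, ‖W x‖ ^ 2 * q x ^ 4 := by
    rw [← integral_const_mul, ← integral_const_mul, ← integral_add (i1.const_mul 2)
      (i2.const_mul _)]
    exact integral_mono_of_nonneg (Eventually.of_forall fun x => by positivity)
      ((i1.const_mul 2).add (i2.const_mul _)) (Eventually.of_forall hfd)
  have e1 : ∀ x, ‖χ x • W x‖ = χ x * ‖W x‖ := fun x => by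
    rw [norm_smul, Real.norm_of_nonneg (hχ0 x)]
  simp only [e1] at key
  refine key.trans (mul_le_mul_of_nonneg_left ?_ (by positivity))
  exact pow_le_pow_left₀ (integral_nonneg fun x => by positivity) hint 3

theorem IsEighthRoot.integrable_mul_pow (h : IsEighthRoot A ψ q) {f : E3 → ℝ}
    (hf : Continuous f) {n : ℕ} (hn : n ≠ 0) : Integrable fun x => f x * q x ^ n := by
  refine (hf.mul (h.cont.pow n)).integrable_of_hasCompactSupport ?_
  refine h.hasCompactSupport.mono fun x hx => ?_
  rw [Function.mem_support] at hx ⊢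
  contrapose! hx
  simp [hx, hn]

/-- The Sobolev inequality for `√ψ W`; since `√ψ` need not be smooth, it is obtained as a limit. -/
theorem IsEighthRoot.integral_pow_six_le (h : IsEighthRoot A ψ q) {c : ℝ}
    (hc : IsSobolevConst c)
    (hW : ContDiff ℝ ∞ W) :
    ∫ x, ‖W x‖ ^ 6 * q x ^ 24 ≤ c ^ 4 * (2 * (∫ x, frobSq (fderiv ℝ W x) * q x ^ 8)
      + A ^ 2 / 2 * ∫ x, ‖W x‖ ^ 2 * q x ^ 4) ^ 3 := by
  have hψ0 : ∀ x, 0 ≤ ψ x := fun x => by rw [← h.pow_eight]; have := h.nonneg x; positivity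
  have hsq : ∀ x, √(ψ x) = q x ^ 4 := fun x => by
    rw [← h.pow_eight, show q x ^ 8 = (q x ^ 4) ^ 2 by ring,
      Real.sqrt_sq (by have := h.nonneg x; positivity)]
  have hlim : Tendsto (fun n : ℕ => ∫ x, ((√(ψ x + 1 / ((n : ℝ) + 1)) - √(1 / ((n : ℝ) + 1)))
      * ‖W x‖) ^ 6) atTop (𝓝 (∫ x, ‖W x‖ ^ 6 * q x ^ 24)) := by
    refine tendsto_integral_of_dominated_convergence (fun x => ‖W x‖ ^ 6 * q x ^ 24) ?_
      (h.integrable_mul_pow (hW.continuous.norm.pow 6) (by norm_num)) ?_ ?_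
    · intro n
      have := h.smooth.continuous
      have := hW.continuous
      exact Continuous.aestronglyMeasurable (by fun_prop)
    · intro n
      refine Eventually.of_forall fun x => ?_
      have hε : (0 : ℝ) ≤ 1 / ((n : ℝ) + 1) := by positivity
      have h1 : √(1 / ((n : ℝ) + 1)) ≤ √(ψ x + 1 / ((n : ℝ) + 1)) :=
        Real.sqrt_le_sqrt (by linarith [hψ0 x])
      have h2 : √(ψ x + 1 / ((n : ℝ) + 1)) - √(1 / ((n : ℝ) + 1)) ≤ q x ^ 4 := by
        rw [← hsq]
        rw [sub_le_iff_le_add, Real.sqrt_le_left (by positivity)]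
        have a1 := Real.sq_sqrt (hψ0 x)
        have a2 := Real.sq_sqrt hε
        have a3 := mul_nonneg (Real.sqrt_nonneg (ψ x)) (Real.sqrt_nonneg (1 / ((n : ℝ) + 1)))
        nlinarith
      have h3 : 0 ≤ √(ψ x + 1 / ((n : ℝ) + 1)) - √(1 / ((n : ℝ) + 1)) := by linarith
      rw [Real.norm_of_nonneg (by positivity)]
      calc _ ≤ (q x ^ 4 * ‖W x‖) ^ 6 := pow_le_pow_left₀ (by positivity)
            (mul_le_mul_of_nonneg_right h2 (norm_nonneg _)) 6
        _ = _ := by ring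
    · refine Eventually.of_forall fun x => ?_
      have hc' : Continuous fun ε : ℝ => ((√(ψ x + ε) - √ε) * ‖W x‖) ^ 6 := by fun_prop
      have := (hc'.tendsto 0).comp (tendsto_one_div_add_atTop_nhds_zero_nat (𝕜 := ℝ))
      have e0 : ((√(ψ x + 0) - √0) * ‖W x‖) ^ 6 = ‖W x‖ ^ 6 * q x ^ 24 := by
        rw [add_zero, Real.sqrt_zero, sub_zero, hsq]; ring
      rw [e0] at this
      exact this
  exact le_of_tendsto hlim (Eventually.of_forall fun n =>
    h.integral_regularized_le hc hW (by positivity))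

/-- The Cauchy-Schwarz inequality for real integrals. -/
theorem integral_mul_le_sqrt_mul_sqrt {α : Type*} [MeasurableSpace α] {μ : Measure α}
    {f g : α → ℝ} (hf0 : ∀ x, 0 ≤ f x) (hg0 : ∀ x, 0 ≤ g x) (hf : MemLp f 2 μ)
    (hg : MemLp g 2 μ) : ∫ x, f x * g x ∂μ ≤ √(∫ x, f x ^ 2 ∂μ) * √(∫ x, g x ^ 2 ∂μ) := by
  have h := integral_mul_le_Lp_mul_Lq_of_nonneg (μ := μ) Real.HolderConjugate.two_two
    (Eventually.of_forall hf0) (Eventually.of_forall hg0) (by simpa using hf) (by simpa using hg)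
  simpa [Real.sqrt_eq_rpow] using h

/-- Young's inequality with a free parameter, in the form `e^{1/4} S^{1/4} ≤ c (λ³ e + g / λ)` for
`S ≤ c⁴ g³`. -/
theorem sqrt_sqrt_mul_sqrt_le {c e S g l : ℝ} (hc : 0 < c) (he : 0 ≤ e) (hS : 0 ≤ S) (hg : 0 ≤ g)
    (hl : 0 < l) (h : S ≤ c ^ 4 * g ^ 3) : √(√e * √S) ≤ c * (l ^ 3 * e + g / l) := by
  have hr : 0 ≤ c * (l ^ 3 * e + g / l) := by positivity
  refine le_of_pow_le_pow_left₀ (n := 4) (by norm_num) hr ?_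
  have e1 : √(√e * √S) ^ 4 = e * S := by
    rw [show √(√e * √S) ^ 4 = (√(√e * √S) ^ 2) ^ 2 by ring, Real.sq_sqrt (by positivity),
      mul_pow, Real.sq_sqrt he, Real.sq_sqrt hS]
  set a := l ^ 3 * e with ha
  set b := g / l with hb
  have ha0 : 0 ≤ a := by positivity
  have hb0 : 0 ≤ b := by positivity
  have e2 : a * b ^ 3 = e * g ^ 3 := by rw [ha, hb]; field_simp
  have e3 : a * b ^ 3 ≤ (a + b) ^ 4 := by
    have : (a + b) ^ 4 = a * b ^ 3 + (a ^ 4 + 4 * a ^ 3 * b + 6 * a ^ 2 * b ^ 2 + 3 * a * b ^ 3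
      + b ^ 4) := by ring
    rw [this]
    exact le_add_of_nonneg_right (by positivity)
  rw [e1, mul_pow]
  calc e * S ≤ e * (c ^ 4 * g ^ 3) := mul_le_mul_of_nonneg_left h he
    _ = c ^ 4 * (a * b ^ 3) := by rw [e2]; ring
    _ ≤ c ^ 4 * (a + b) ^ 4 := mul_le_mul_of_nonneg_left e3 (by positivity)

/-- The estimate of the transport term: Hölder's inequality with exponents `2, 4, 4` applied to
`|V|`, `(|W| ψ^{1/4})^{1/2}` and `(|W| ψ^{1/2})^{3/2}`, followed by the Sobolev and the Young
inequality. This is the step that needs `|∇ψ| ≲ ψ^{7/8}`. -/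
theorem IsEighthRoot.integral_transport_le (h : IsEighthRoot A ψ q) {c : ℝ} (hc0 : 0 < c)
    (hc : IsSobolevConst c)
    (hW : ContDiff ℝ ∞ W) (hV : Continuous V) {r M : ℝ} (hsupp : tsupport ψ ⊆ ball 0 r)
    (hM : ∫ x in ball 0 r, ‖V x‖ ^ 2 ≤ M) {l : ℝ} (hl : 0 < l) :
    ∫ x, ‖V x‖ * ‖W x‖ ^ 2 * q x ^ 7 ≤ √M * (c * (l ^ 3 * (∫ x, ‖W x‖ ^ 2 * q x ^ 4)
      + (2 * (∫ x, frobSq (fderiv ℝ W x) * q x ^ 8)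
      + A ^ 2 / 2 * ∫ x, ‖W x‖ ^ 2 * q x ^ 4) / l)) := by
  have hq0 := h.nonneg
  have hWc := hW.continuous
  have hqc := h.cont
  have cs : ∀ {f : E3 → ℝ} {n : ℕ}, n ≠ 0 → HasCompactSupport fun x => f x * q x ^ n := by
    intro f n hn
    refine h.hasCompactSupport.mono fun x hx => ?_
    rw [Function.mem_support] at hx ⊢
    contrapose! hx
    simp [hx, hn]
  have hq_out : ∀ x ∉ ball (0 : E3) r, q x = 0 := by
    intro x hx
    have : ψ x = 0 := image_eq_zero_of_notMem_tsupport fun hm => hx (hsupp hm)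
    rw [← h.pow_eight] at this
    exact pow_eq_zero_iff (by norm_num) |>.1 this
  have s1 : ∫ x, ‖V x‖ * ‖W x‖ ^ 2 * q x ^ 7
      = ∫ x in ball 0 r, ‖V x‖ * (‖W x‖ ^ 2 * q x ^ 7) := by
    rw [setIntegral_eq_integral_of_forall_compl_eq_zero fun x hx => by simp [hq_out x hx]]
    simp only [mul_assoc]
  have mV : MemLp (fun x => ‖V x‖) 2 (volume.restrict (ball (0 : E3) r)) := by
    obtain ⟨B, hB⟩ := (isCompact_closedBall (0 : E3) r).exists_bound_of_continuousOn
      hV.norm.continuousOn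
    have : IsFiniteMeasure (volume.restrict (ball (0 : E3) r)) :=
      ⟨by simpa using (measure_ball_lt_top : volume (ball (0 : E3) r) < ⊤)⟩
    refine MemLp.of_bound hV.norm.aestronglyMeasurable B ?_
    filter_upwards [ae_restrict_mem measurableSet_ball] with x hx
    exact hB x (ball_subset_closedBall hx)
  have mW : MemLp (fun x => ‖W x‖ ^ 2 * q x ^ 7) 2 (volume : Measure E3) :=
    memLp_of_continuous_of_hasCompactSupport (by fun_prop) (cs (by norm_num)) 2
  have s2 := integral_mul_le_sqrt_mul_sqrt (fun x => norm_nonneg (V x))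
    (fun x => by have := hq0 x; positivity) mV (mW.restrict (ball (0 : E3) r))
  have s3 : ∫ x in ball 0 r, (‖W x‖ ^ 2 * q x ^ 7) ^ 2
      = ∫ x, (‖W x‖ * q x ^ 2) * (‖W x‖ ^ 3 * q x ^ 12) := by
    rw [setIntegral_eq_integral_of_forall_compl_eq_zero fun x hx => by simp [hq_out x hx]]
    congr 1
    funext x
    ring
  have s4 := integral_mul_le_sqrt_mul_sqrt (μ := volume) (f := fun x => ‖W x‖ * q x ^ 2)
    (g := fun x => ‖W x‖ ^ 3 * q x ^ 12)
    (fun x => by have := hq0 x; positivity) (fun x => by have := hq0 x; positivity)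
    (memLp_of_continuous_of_hasCompactSupport (by fun_prop) (cs (by norm_num)) 2)
    (memLp_of_continuous_of_hasCompactSupport (by fun_prop) (cs (by norm_num)) 2)
  have e1 : ∀ x, (‖W x‖ * q x ^ 2) ^ 2 = ‖W x‖ ^ 2 * q x ^ 4 := fun x => by ring
  have e2 : ∀ x, (‖W x‖ ^ 3 * q x ^ 12) ^ 2 = ‖W x‖ ^ 6 * q x ^ 24 := fun x => by ring
  simp only [e1, e2] at s4
  have he : 0 ≤ ∫ x, ‖W x‖ ^ 2 * q x ^ 4 :=
    integral_nonneg fun x => by have := hq0 x; positivity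
  have hS : 0 ≤ ∫ x, ‖W x‖ ^ 6 * q x ^ 24 :=
    integral_nonneg fun x => by have := hq0 x; positivity
  have hd : 0 ≤ ∫ x, frobSq (fderiv ℝ W x) * q x ^ 8 :=
    integral_nonneg fun x => by have := hq0 x; have := frobSq_nonneg (fderiv ℝ W x); positivity
  have s5 := sqrt_sqrt_mul_sqrt_le hc0 he hS (by positivity) hl (h.integral_pow_six_le hc hW)
  rw [s1]
  refine s2.trans (mul_le_mul (Real.sqrt_le_sqrt hM) ?_ (Real.sqrt_nonneg _) (Real.sqrt_nonneg _))
  rw [s3]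
  exact (Real.sqrt_le_sqrt s4).trans s5

end Weighted

/-! ### The cut-offs of a cover -/

/-- The complement of a cone `⟨x, a⟩ = c |x|` is dense: otherwise the quadratic form
`⟨x, a⟩² - c² |x|²` would vanish identically. -/
theorem dense_inner_ne_mul_norm {a : E3} (ha : a ≠ 0) (c : ℝ) :
    Dense {x : E3 | ⟪x, a⟫_ℝ ≠ c * ‖x‖} := by
  rw [dense_iff_inter_open]
  rintro U hU ⟨x, hx⟩
  by_contra hempty
  have hz : ∀ z ∈ U, ⟪z, a⟫_ℝ ^ 2 - c ^ 2 * ‖z‖ ^ 2 = 0 := by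
    intro z hzU
    have : ⟪z, a⟫_ℝ = c * ‖z‖ := by
      by_contra hne
      exact hempty ⟨z, hzU, hne⟩
    rw [this]; ring
  have hq : ∀ v : E3, ⟪v, a⟫_ℝ ^ 2 = c ^ 2 * ‖v‖ ^ 2 := by
    intro v
    have hcont : Continuous fun t : ℝ => x + t • v := by fun_prop
    have hnhds : ∀ᶠ t in 𝓝 (0 : ℝ), x + t • v ∈ U :=
      hcont.continuousAt.eventually_mem (by simpa using hU.mem_nhds hx)
    obtain ⟨ε, hε, hball⟩ := Metric.eventually_nhds_iff.1 hnhds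
    have h1 := hz _ (hball (y := ε / 2) (by
      rw [Real.dist_eq, sub_zero, abs_of_pos] <;> linarith))
    have h2 := hz _ (hball (y := -(ε / 2)) (by
      rw [Real.dist_eq, sub_zero, abs_neg, abs_of_pos] <;> linarith))
    have h3 := hz x hx
    rw [norm_add_sq_real] at h1 h2
    simp only [inner_add_left, inner_smul_left, inner_smul_right, norm_smul, mul_pow,
      Real.norm_eq_abs, sq_abs, conj_trivial] at h1 h2
    have h4 : (ε / 2) ^ 2 * (⟪v, a⟫_ℝ ^ 2 - c ^ 2 * ‖v‖ ^ 2) = 0 := by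
      linear_combination (h1 + h2) / 2 - h3
    have h5 := (mul_eq_zero.1 h4).resolve_left (by positivity)
    linarith
  have hcoord : ∀ l, a l ^ 2 = c ^ 2 := by
    intro l
    have := hq (e l)
    simpa [e, EuclideanSpace.inner_single_left] using this
  have h01 : a 0 * a 1 = 0 := by
    have h1 := hq (e 0 + e 1)
    rw [norm_add_sq_real] at h1
    simp [e, EuclideanSpace.inner_single_left, inner_add_left] at h1
    nlinarith [hcoord 0, hcoord 1]
  have hc : c ^ 2 = 0 := by
    have : (c ^ 2) ^ 2 = 0 := by
      calc (c ^ 2) ^ 2 = a 0 ^ 2 * a 1 ^ 2 := by rw [hcoord, hcoord]; ring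
        _ = 0 := by rw [← mul_pow, h01]; simp
    exact pow_eq_zero_iff (by norm_num) |>.1 this
  refine ha ?_
  ext l
  have := hcoord l
  rw [hc] at this
  simpa using this

section Cutoffs

variable {C₀ ρ₂ R₀ R : ℝ} {ψ₀ ψ : E3 → ℝ} {x₀ : E3}

theorem IsCoverCutoff.exists_isSpaceCutoff (h : IsCoverCutoff C₀ ρ₂ R₀ R ψ₀ x₀ ψ) :
    ∃ U A, IsSpaceCutoff C₀ ρ₂ R U A ψ := by
  by_cases hb : ball x₀ R ⊆ ball 0 R₀
  · exact ⟨_, _, h.interior hb⟩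
  · exact ⟨_, _, (h.boundary hb).1⟩

theorem IsCoverCutoff.nonneg (h : IsCoverCutoff C₀ ρ₂ R₀ R ψ₀ x₀ ψ) (x : E3) : 0 ≤ ψ x := by
  obtain ⟨U, A, h'⟩ := h.exists_isSpaceCutoff
  exact h'.nonneg x

theorem IsCoverCutoff.le_outer (h : IsCoverCutoff C₀ ρ₂ R₀ R ψ₀ x₀ ψ) (x : E3) : ψ x ≤ ψ₀ x :=
  h.1 x

/-- The radial projection onto the sphere `S(0,R₀)`. -/
noncomputable def radial (R₀ : ℝ) (x : E3) : E3 := (R₀ / ‖x‖) • x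

theorem norm_radial (hR₀ : 0 < R₀) {x : E3} (hx : x ≠ 0) : ‖radial R₀ x‖ = R₀ := by
  have := norm_pos_iff.2 hx
  rw [radial, norm_smul, Real.norm_of_nonneg (by positivity)]
  field_simp

theorem radial_smul (hR₀ : 0 < R₀) {x : E3} (hx : x ≠ 0) : x = (‖x‖ / R₀) • radial R₀ x := by
  have := norm_pos_iff.2 hx
  rw [radial, smul_smul, show ‖x‖ / R₀ * (R₀ / ‖x‖) = 1 by field_simp, one_smul]

theorem mem_coneShell_iff (hR₀ : 0 < R₀) {r : ℝ} {x : E3} (h1 : R₀ ≤ ‖x‖) (h2 : ‖x‖ ≤ 2 * R₀) :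
    x ∈ coneShell R₀ x₀ r ↔ radial R₀ x ∈ ball x₀ r := by
  have hx : x ≠ 0 := norm_pos_iff.1 (hR₀.trans_le h1)
  have hxpos := norm_pos_iff.2 hx
  constructor
  · rintro ⟨-, -, y, ⟨hy, hyb⟩, l, hl, rfl⟩
    rw [mem_sphere_zero_iff_norm] at hy
    have hl' : l ≠ 0 := fun h0 => hx (by simp [h0])
    have : radial R₀ (l • y) = y := by
      rw [radial, norm_smul, hy, Real.norm_of_nonneg hl, smul_smul]
      rw [show R₀ / (l * R₀) * l = 1 by field_simp, one_smul]
    rwa [this]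
  · intro h
    exact ⟨h1, h2, radial R₀ x, ⟨by simpa using norm_radial hR₀ hx, h⟩, ‖x‖ / R₀, by positivity,
      radial_smul hR₀ hx⟩

/-- The radial projection from outside `B(0,R₀)` does not increase the distance to points of the
ball. -/
theorem dist_radial_le (hR₀ : 0 < R₀) {x a : E3} (hx : R₀ ≤ ‖x‖) (ha : ‖a‖ ≤ R₀) :
    dist (radial R₀ x) a ≤ dist x a := by
  have hx0 : x ≠ 0 := norm_pos_iff.1 (hR₀.trans_le hx)
  set y := radial R₀ x
  set κ := ‖x‖ / R₀
  have hκ : 1 ≤ κ := (one_le_div hR₀).2 hx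
  have hy : ‖y‖ = R₀ := norm_radial hR₀ hx0
  rw [radial_smul hR₀ hx0, dist_eq_norm, dist_eq_norm]
  refine le_of_pow_le_pow_left₀ (n := 2) (by norm_num) (norm_nonneg _) ?_
  change ‖y - a‖ ^ 2 ≤ ‖κ • y - a‖ ^ 2
  rw [norm_sub_sq_real, norm_sub_sq_real, inner_smul_left, norm_smul, hy,
    Real.norm_of_nonneg (by linarith), conj_trivial]
  have h1 : ⟪y, a⟫_ℝ ≤ R₀ * R₀ := by
    refine (real_inner_le_norm y a).trans ?_
    rw [hy]
    exact mul_le_mul_of_nonneg_left ha hR₀.le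
  have h2 : 0 ≤ (κ - 1) * (R₀ * R₀ - ⟪y, a⟫_ℝ) := mul_nonneg (by linarith) (by linarith)
  have h3 : 0 ≤ (κ - 1) * (κ - 1) * (R₀ * R₀) := by
    have : 0 ≤ κ - 1 := by linarith
    positivity
  nlinarith

/-- Where a cut-off does not vanish outside `B(0,R₀)`, the radial projection lies in the doubled
cover element. -/
theorem IsCoverCutoff.radial_mem (hR₀ : 0 < R₀) (hR : 0 < R)
    (h : IsCoverCutoff C₀ ρ₂ R₀ R ψ₀ x₀ ψ) {x : E3} (h1 : R₀ ≤ ‖x‖) (h2 : ‖x‖ ≤ 2 * R₀)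
    (hx : ψ x ≠ 0) : radial R₀ x ∈ ball x₀ (2 * R) := by
  by_cases hb : ball x₀ R ⊆ ball 0 R₀
  · have hx' : x ∈ ball x₀ (2 * R) := (h.interior hb).supp (subset_tsupport _ hx)
    have hx₀ : ‖x₀‖ ≤ R₀ := by
      have := hb (mem_ball_self hR)
      rw [mem_ball_zero_iff] at this
      exact this.le
    exact (dist_radial_le hR₀ h1 hx₀).trans_lt hx'
  · rw [← mem_coneShell_iff hR₀ h1 h2]
    by_contra hn
    exact hx ((h.boundary hb).2.2.2 x h1 h2 hn)

theorem IsCoverCutoff.mem_of_ne_zero (h : IsCoverCutoff C₀ ρ₂ R₀ R ψ₀ x₀ ψ) {x : E3}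
    (h1 : ‖x‖ < R₀) (hx : ψ x ≠ 0) : x ∈ ball x₀ (2 * R) := by
  by_cases hb : ball x₀ R ⊆ ball 0 R₀
  · exact (h.interior hb).supp (subset_tsupport _ hx)
  · by_contra hn
    exact hx ((h.boundary hb).2.2.1 x ⟨by simpa using h1, hn⟩)

theorem IsSpaceCutoff.norm_lt_of_ne_zero {r : ℝ} {A : Set E3}
    (h : IsSpaceCutoff C₀ ρ₂ R (ball 0 r) A ψ) {x : E3} (hx : ψ x ≠ 0) : ‖x‖ < r := by
  simpa using h.supp (subset_tsupport _ hx)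

end Cutoffs

section Cover

variable {C₀ ρ₂ R₀ R : ℝ} {ψ₀ : E3 → ℝ} {K₁ K₂ n : ℕ} {x : Fin n → E3} {ψ : Fin n → E3 → ℝ}

/-- At most `K₂` of the cut-offs are nonzero at any point. -/
theorem card_cutoff_ne_zero_le (hR₀ : 0 < R₀)
    (h₀ : IsSpaceCutoff C₀ ρ₂ R₀ (ball 0 (2 * R₀)) (ball 0 R₀) ψ₀)
    (hx : IsKCover K₁ K₂ R₀ R x) (hψ : ∀ i, IsCoverCutoff C₀ ρ₂ R₀ R ψ₀ (x i) (ψ i)) (y : E3) :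
    (Finset.univ.filter fun i => ψ i y ≠ 0).card ≤ K₂ := by
  have key : ∀ z ∈ ball (0 : E3) R₀, (∀ i, ψ i y ≠ 0 → z ∈ ball (x i) (2 * R)) →
      (Finset.univ.filter fun i => ψ i y ≠ 0).card ≤ K₂ := by
    intro z hz hi
    refine le_trans ?_ (hx.multiplicity z hz)
    rw [← Set.ncard_coe_finset]
    exact Set.ncard_le_ncard (fun i hi' => hi i (by simpa using hi')) (Set.toFinite _)
  rcases lt_or_ge ‖y‖ R₀ with hy | hy
  · exact key y (by simpa using hy) fun i hi => (hψ i).mem_of_ne_zero hy hi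
  by_cases h0 : ψ₀ y = 0
  · have : (Finset.univ.filter fun i => ψ i y ≠ 0) = ∅ := by
      refine Finset.filter_eq_empty_iff.2 fun i _ => ?_
      rw [not_not]
      exact le_antisymm (((hψ i).le_outer y).trans h0.le) ((hψ i).nonneg y)
    simp [this]
  have hy2 := (h₀.norm_lt_of_ne_zero h0).le
  have hy0 : y ≠ 0 := norm_pos_iff.1 (hR₀.trans_le hy)
  -- The projection `w` of `y` lies on the sphere, where the multiplicity bound says nothing; a
  -- point of the open ball near `w` lies in the same doubled cover elements.
  set w := radial R₀ y
  set O : Set E3 := ⋂ i ∈ {i | ψ i y ≠ 0}, ball (x i) (2 * R) with hO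
  have hOo : IsOpen O := (Set.toFinite _).isOpen_biInter fun i _ => isOpen_ball
  have hwO : w ∈ O := by
    simp only [hO, mem_iInter]
    exact fun i hi => (hψ i).radial_mem hR₀ hx.pos hy hy2 hi
  have hwc : w ∈ closure (ball (0 : E3) R₀) := by
    rw [closure_ball _ hR₀.ne', mem_closedBall_zero_iff]
    exact (norm_radial hR₀ hy0).le
  obtain ⟨z, hzO, hz⟩ := mem_closure_iff.1 hwc O hOo hwO
  refine key z hz fun i hi => ?_
  simp only [hO, mem_iInter] at hzO
  exact hzO i hi

theorem sum_cutoff_le_of_card_le {g : Fin n → ℝ} {b : ℝ} (hb : 0 ≤ b)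
    (hcard : (Finset.univ.filter fun i => g i ≠ 0).card ≤ K₂) (hg : ∀ i, g i ≤ b) :
    ∑ i, g i ≤ K₂ * b := by
  rw [← Finset.sum_filter_ne_zero]
  refine (Finset.sum_le_card_nsmul _ _ b fun i _ => hg i).trans ?_
  rw [nsmul_eq_mul]
  exact mul_le_mul_of_nonneg_right (by exact_mod_cast hcard) hb

/-- The cut-offs of a cover add up to at least the cut-off `ψ₀` at the largest scale. Outside
`B(0,R₀)` this is clear on the cones through the open cover elements; these miss only a nowhere
dense set, so the general case follows by continuity. -/
theorem le_sum_cutoff (hR₀ : 0 < R₀)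
    (h₀ : IsSpaceCutoff C₀ ρ₂ R₀ (ball 0 (2 * R₀)) (ball 0 R₀) ψ₀)
    (hx : IsKCover K₁ K₂ R₀ R x) (hψ : ∀ i, IsCoverCutoff C₀ ρ₂ R₀ R ψ₀ (x i) (ψ i)) (y : E3) :
    ψ₀ y ≤ ∑ i, ψ i y := by
  have hsingle : ∀ z i, ψ₀ z ≤ ψ i z → ψ₀ z ≤ ∑ i, ψ i z := fun z i hz =>
    hz.trans (Finset.single_le_sum (f := fun i => ψ i z) (fun j _ => (hψ j).nonneg z)
      (Finset.mem_univ i))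
  by_cases hcen : ∃ i, x i = 0 ∧ R = R₀
  · obtain ⟨i, hi, hR⟩ := hcen
    exact hsingle y i (le_of_eq (congrFun ((hψ i).at_origin hi hR) y).symm)
  push Not at hcen
  set c : Fin n → ℝ := fun i => (R₀ ^ 2 + ‖x i‖ ^ 2 - R ^ 2) / (2 * R₀) with hc
  set N : Fin n → Set E3 := fun i => {z | x i ≠ 0 → ⟪z, x i⟫_ℝ ≠ c i * ‖z‖} with hN
  have hNo : ∀ i, IsOpen (N i) := by
    intro i
    by_cases hi : x i = 0
    · simp [hN, hi]
    · have : N i = {z | ⟪z, x i⟫_ℝ ≠ c i * ‖z‖} := by ext z; simp [hN, hi]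
      rw [this]
      exact isOpen_ne_fun (by fun_prop) (by fun_prop)
  have hNd : ∀ i, Dense (N i) := by
    intro i
    by_cases hi : x i = 0
    · simp [hN, hi]
    · exact (dense_inner_ne_mul_norm hi (c i)).mono fun z hz _ => hz
  have hdense : Dense (⋂ i, N i) := dense_iInter_of_isOpen hNo hNd
  have hψc : ∀ i, Continuous (ψ i) := fun i => by
    obtain ⟨U, A, h⟩ := (hψ i).exists_isSpaceCutoff
    exact h.smooth.continuous
  have hclosed : IsClosed {z | ψ₀ z ≤ ∑ i, ψ i z} :=
    isClosed_le h₀.smooth.continuous (continuous_finsetSum _ fun i _ => hψc i)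
  suffices hsub : ⋂ i, N i ⊆ {z | ψ₀ z ≤ ∑ i, ψ i z} from
    closure_minimal hsub hclosed (hdense y)
  intro z hz
  rw [mem_iInter] at hz
  rcases lt_or_ge ‖z‖ R₀ with hzR | hzR
  · have hzb : z ∈ ball (0 : E3) R₀ := by simpa using hzR
    obtain ⟨i, hi⟩ := mem_iUnion.1 (hx.covers hzb)
    refine hsingle z i ((h₀.le_one z).trans (le_of_eq ?_))
    by_cases hb : ball (x i) R ⊆ ball 0 R₀
    · exact (((hψ i).interior hb).eq_one z hi).symm
    · exact (((hψ i).boundary hb).1.eq_one z ⟨hi, hzb⟩).symm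
  by_cases h0 : ψ₀ z = 0
  · show ψ₀ z ≤ _
    rw [h0]
    exact Finset.sum_nonneg fun i _ => (hψ i).nonneg z
  have hz2 := (h₀.norm_lt_of_ne_zero h0).le
  have hz0 : z ≠ 0 := norm_pos_iff.1 (hR₀.trans_le hzR)
  have hzpos := norm_pos_iff.2 hz0
  have hwn := norm_radial hR₀ hz0
  have hwz := radial_smul hR₀ hz0
  set w := radial R₀ z with hw
  have hwc : w ∈ ⋃ i, closedBall (x i) R := by
    have hcl : IsClosed (⋃ i, closedBall (x i) R) :=
      isClosed_iUnion_of_finite fun i => isClosed_closedBall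
    refine closure_minimal (hx.covers.trans (iUnion_mono fun i => ball_subset_closedBall)) hcl ?_
    rw [closure_ball _ hR₀.ne', mem_closedBall_zero_iff]
    exact hwn.le
  obtain ⟨i, hi⟩ := mem_iUnion.1 hwc
  have hlt : w ∈ ball (x i) R := by
    refine mem_ball.2 (lt_of_le_of_ne hi fun heq => ?_)
    by_cases hxi : x i = 0
    · rw [hxi, dist_zero_right, hwn] at heq
      exact hcen i hxi heq.symm
    · refine hz i hxi ?_
      have h1 : ‖w - x i‖ ^ 2 = R ^ 2 := by rw [← dist_eq_norm, heq]
      rw [norm_sub_sq_real, hwn] at h1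
      rw [hwz, inner_smul_left, norm_smul, hwn, conj_trivial, Real.norm_of_nonneg (by positivity)]
      simp only [hc]
      field_simp
      linarith
  have hnb : ¬ ball (x i) R ⊆ ball 0 R₀ := by
    intro hb
    have := hb hlt
    rw [mem_ball_zero_iff, hwn] at this
    exact lt_irrefl _ this
  exact hsingle z i (le_of_eq (((hψ i).boundary hnb).2.1 z
    ((mem_coneShell_iff hR₀ hzR hz2).2 hlt)).symm)

end Cover

/-! ### The energy bound and the averaged quantities -/

section Energy

variable {u : ℝ → E3 → E3} {T R₀ : ℝ}

/-- The uniformly local energy bound, which is given for almost every time, extends to every time in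
`(0,T)` by Fatou's lemma. -/
theorem exists_ulocBound (hL : IsLocalLeray u) (hu : IsRegularOn u T) (hT : 0 < T) :
    ∃ M : ℝ≥0, ∀ s ∈ Ioo 0 T, UlocBound (u s) M := by
  obtain ⟨u₀, G, p, h⟩ := hL
  obtain ⟨M, hM⟩ := h.energy T hT
  rw [ae_restrict_iff' measurableSet_Ioo] at hM
  refine ⟨M, fun s hs x₀ => ?_⟩
  have hd : Dense {s | s ∈ Ioo 0 T → UlocBound (u s) M} := Measure.dense_of_ae hM
  obtain ⟨r, hr, hlim⟩ := mem_closure_iff_seq_limit.1 (hd.open_subset_closure_inter isOpen_Ioo hs)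
  have hc : ContinuousOn (fun z : ℝ × E3 => u z.1 z.2) (slab T) := hu.continuousOn
  have hpt : ∀ x, ‖u s x‖ₑ ^ 2 = liminf (fun n => ‖u (r n) x‖ₑ ^ 2) atTop := by
    intro x
    have h1 : ContinuousAt (fun z : ℝ × E3 => u z.1 z.2) (s, x) :=
      hc.continuousAt ((isOpen_slab T).mem_nhds (mem_slab hs x))
    have h2 : Tendsto (fun n => u (r n) x) atTop (𝓝 (u s x)) :=
      h1.tendsto.comp (hlim.prodMk_nhds tendsto_const_nhds)
    have h3 : Continuous fun v : E3 => ‖v‖ₑ ^ 2 := by fun_prop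
    exact (((h3.tendsto _).comp h2).liminf_eq).symm
  have hmeas : ∀ n, Measurable fun x => ‖u (r n) x‖ₑ ^ 2 := by
    intro n
    have : Continuous fun x => u (r n) x :=
      continuousOn_univ.1 (hc.comp (by fun_prop : Continuous fun x : E3 => (r n, x)).continuousOn
        fun x _ => mem_slab (hr n).1 x)
    have h3 : Continuous fun x => ‖u (r n) x‖ₑ ^ 2 := by fun_prop
    exact h3.measurable
  simp only [hpt]
  refine (lintegral_liminf_le hmeas).trans ?_
  refine liminf_le_of_le (by isBoundedDefault) fun b hb => ?_
  obtain ⟨n, hn⟩ := hb.exists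
  exact hn.trans ((hr n).2 (hr n).1 x₀)

theorem M0_lt_top (hL : IsLocalLeray u) (hu : IsRegularOn u T) (hT : 0 < T) :
    M0 u T R₀ < ⊤ := by
  obtain ⟨M, hM⟩ := exists_ulocBound hL hu hT
  obtain ⟨F, -, hF⟩ := (isCompact_closedBall (0 : E3) (2 * R₀)).elim_nhds_subcover
    (fun x => ball x 1) fun x _ => ball_mem_nhds x one_pos
  refine lt_of_le_of_lt (b := ∑ _x ∈ F, (M : ℝ≥0∞)) ?_ (by
    simpa using ENNReal.mul_lt_top (ENNReal.natCast_lt_top _) ENNReal.coe_lt_top)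
  refine iSup₂_le fun s hs => ?_
  calc ∫⁻ x in ball 0 (2 * R₀), ‖u s x‖ₑ ^ 2
      ≤ ∫⁻ x in ⋃ y ∈ F, ball y 1, ‖u s x‖ₑ ^ 2 :=
        lintegral_mono_set (ball_subset_closedBall.trans hF)
    _ ≤ ∑ y ∈ F, ∫⁻ x in ball y 1, ‖u s x‖ₑ ^ 2 := by
        rw [← Finset.tsum_subtype]
        exact (lintegral_mono_set (biUnion_eq_iUnion _ _).subset).trans (lintegral_iUnion_le _ _)
    _ ≤ ∑ _y ∈ F, (M : ℝ≥0∞) := Finset.sum_le_sum fun y _ => hM s hs y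

theorem integral_norm_sq_le_M0 (hu : IsRegularOn u T) (hM : M0 u T R₀ < ⊤) {s : ℝ}
    (hs : s ∈ Ioo 0 T) : ∫ x in ball 0 (2 * R₀), ‖u s x‖ ^ 2 ≤ (M0 u T R₀).toReal := by
  have hc : Continuous (u s) := (smooth_slice hu hs).continuous
  rw [integral_eq_lintegral_of_nonneg_ae (Eventually.of_forall fun x => by positivity)
    (by fun_prop : Continuous fun x => ‖u s x‖ ^ 2).aestronglyMeasurable]
  refine ENNReal.toReal_mono hM.ne ?_
  have : ∀ x, ENNReal.ofReal (‖u s x‖ ^ 2) = ‖u s x‖ₑ ^ 2 := fun x => by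
    rw [ENNReal.ofReal_pow (norm_nonneg _), ofReal_norm]
  simp only [this]
  exact le_iSup₂ (f := fun s (_ : s ∈ Ioo 0 T) => ∫⁻ x in ball 0 (2 * R₀), ‖u s x‖ₑ ^ 2) s hs

end Energy

section Translation

variable {u : ℝ → E3 → E3} {T s : ℝ}

theorem pd_eq_dd (hu : IsRegularOn u T) (hs : s ∈ Ioo 0 T) (x : E3) (j k : Fin 3) :
    pd (u s) j k x = dd (ex j) (comp u k) (s, x) := by
  rw [pd, fderiv_coord ((smooth_slice hu hs).differentiable (by simp) x)]
  exact dd_slice (differentiableAt_of_smoothOn (isOpen_slab T) (comp_smoothOn hu k)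
    (mem_slab hs x)) j

theorem curl_eq_vort (hu : IsRegularOn u T) (hs : s ∈ Ioo 0 T) (x : E3) (k : Fin 3) :
    curl (u s) x k = vort u k (s, x) := by
  fin_cases k <;> simp [curl, vort, pd_eq_dd hu hs]

theorem curl_contDiff (hu : IsRegularOn u T) (hs : s ∈ Ioo 0 T) : ContDiff ℝ ∞ (curl (u s)) := by
  refine contDiff_euclidean.2 fun k => ?_
  simp only [curl_eq_vort hu hs]
  exact smooth_slice (vort_smoothOn hu k) hs

theorem norm_curl_sq (hu : IsRegularOn u T) (hs : s ∈ Ioo 0 T) (x : E3) :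
    ‖curl (u s) x‖ ^ 2 = 2 * enst u (s, x) := by
  rw [EuclideanSpace.norm_sq_eq, enst]
  simp only [Real.norm_eq_abs, sq_abs, curl_eq_vort hu hs]
  simp only [← pow_two]
  ring

theorem frobSq_curl (hu : IsRegularOn u T) (hs : s ∈ Ioo 0 T) (x : E3) :
    frobSq (fderiv ℝ (curl (u s)) x) = palin u (s, x) := by
  have hd := (curl_contDiff hu hs).differentiable (by simp) x
  simp only [frobSq, palin, EuclideanSpace.norm_sq_eq, Real.norm_eq_abs, sq_abs]
  refine Finset.sum_congr rfl fun l _ => Finset.sum_congr rfl fun k _ => ?_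
  have : (fderiv ℝ (curl (u s)) x (e l)) k = dd (ex l) (vort u k) (s, x) := by
    rw [fderiv_coord hd]
    simp only [curl_eq_vort hu hs]
    exact dd_slice (differentiableAt_of_smoothOn (isOpen_slab T) (vort_smoothOn hu k)
      (mem_slab hs x)) l
  rw [this, pow_two]

theorem inner_stretch (hu : IsRegularOn u T) (hs : s ∈ Ioo 0 T) (x : E3) (c : ℝ) :
    ⟪fderiv ℝ (u s) x (curl (u s) x), c • curl (u s) x⟫_ℝ = stretch u (s, x) * c := by
  have h1 : ∀ k, (fderiv ℝ (u s) x (curl (u s) x)) k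
      = ∑ j, vort u j (s, x) * dd (ex j) (comp u k) (s, x) := by
    intro k
    conv_lhs => rw [sum_coord_smul_e (curl (u s) x)]
    rw [map_sum, WithLp.ofLp_sum, Finset.sum_apply]
    refine Finset.sum_congr rfl fun j _ => ?_
    rw [map_smul, ← pd_eq_dd hu hs, ← curl_eq_vort hu hs]
    rfl
  rw [inner_smul_right, inner_eq_sum, stretch, mul_comm]
  simp only [h1, curl_eq_vort hu hs]

variable {η : ℝ → ℝ} {ψ q : E3 → ℝ} {R t : ℝ}

theorem intervalIntegral_congr_Ioo {f g : ℝ → ℝ} (ht0 : 0 < t) (ht : t < T)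
    (h : ∀ s ∈ Ioo 0 T, f s = g s) : ∫ s in 0..t, f s = ∫ s in 0..t, g s := by
  refine intervalIntegral.integral_congr_ae (Eventually.of_forall fun s hs => ?_)
  rw [uIoc_of_le ht0.le] at hs
  exact h s ⟨hs.1, hs.2.trans_lt ht⟩

theorem VST_eq (hu : IsRegularOn u T) (ht0 : 0 < t) (ht : t < T) :
    VST u η ψ R t = 1 / t * (1 / R ^ 3) * ∫ s in 0..t, η s * spaceInt (stretch u) ψ s := by
  rw [VST, mul_assoc]
  congr 1
  rw [← intervalIntegral.integral_const_mul]
  refine intervalIntegral_congr_Ioo ht0 ht fun s hs => ?_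
  congr 1
  rw [spaceInt, ← integral_const_mul]
  congr 1
  funext x
  rw [inner_stretch hu hs]
  ring

theorem P0_eq (hu : IsRegularOn u T) (ht0 : 0 < t) (ht : t < T) :
    P0 u η ψ R t = 1 / t * (1 / R ^ 3) * ((∫ s in 0..t, η s * spaceInt (palin u) ψ s)
      + spaceInt (enst u) ψ t) := by
  have e1 : (∫ s in 0..t, 1 / R ^ 3 * ∫ x, frobSq (fderiv ℝ (curl (u s)) x) * (ψ x * η s))
      = 1 / R ^ 3 * ∫ s in 0..t, η s * spaceInt (palin u) ψ s := by
    rw [← intervalIntegral.integral_const_mul]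
    refine intervalIntegral_congr_Ioo ht0 ht fun s hs => ?_
    congr 1
    rw [spaceInt, ← integral_const_mul]
    congr 1
    funext x
    rw [frobSq_curl hu hs]
    ring
  have e2 : ∫ x, 1 / 2 * ‖curl (u t) x‖ ^ 2 * ψ x = spaceInt (enst u) ψ t := by
    rw [spaceInt]
    congr 1
    funext x
    rw [norm_curl_sq hu ⟨ht0, ht⟩]
    ring
  rw [P0, e1, e2]
  ring

theorem E0_eq (hu : IsRegularOn u T) (ht0 : 0 < t) (ht : t < T)
    (hq : ∀ x, 0 ≤ q x) (hψ : ∀ x, q x ^ 8 = ψ x) :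
    E0 u η ψ R t = 1 / t * (1 / R ^ 3) * ∫ s in 0..t, √(η s) * spaceInt (enst u)
      (fun x => q x ^ 4) s := by
  rw [E0, mul_assoc]
  congr 1
  rw [← intervalIntegral.integral_const_mul]
  refine intervalIntegral_congr_Ioo ht0 ht fun s hs => ?_
  congr 1
  rw [spaceInt, ← integral_const_mul]
  congr 1
  funext x
  have h1 : (ψ x * η s) ^ (1 / 2 : ℝ) = q x ^ 4 * √(η s) := by
    have h2 := hq x
    rw [← Real.sqrt_eq_rpow, Real.sqrt_mul (by rw [← hψ]; positivity), ← hψ,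
      show q x ^ 8 = (q x ^ 4) ^ 2 by ring, Real.sqrt_sq (by positivity)]
  rw [h1, norm_curl_sq hu hs]
  ring

end Translation

/-! ### The error terms -/

section Aggregate

variable {C₀ ρ₂ R₀ R : ℝ} {ψ₀ : E3 → ℝ} {K₁ K₂ n : ℕ} {x : Fin n → E3} {ψ : Fin n → E3 → ℝ}

/-- What the estimates use of the sum `Ψ` of the cut-offs of a cover, in terms of `q = ψ₀^{1/8}`. -/
structure IsAggregate (K₂ : ℕ) (C₀ R : ℝ) (ψ₀ q Ψ : E3 → ℝ) : Prop where
  bump : IsBump univ Ψ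
  ge : ∀ y, ψ₀ y ≤ Ψ y
  le : ∀ y, Ψ y ≤ K₂ * ψ₀ y
  grad_le : ∀ y, ‖fderiv ℝ Ψ y‖ ≤ K₂ * C₀ / R * q y ^ 7
  lap_le : ∀ y, |Δ Ψ y| ≤ K₂ * C₀ / R ^ 2 * q y ^ 4

theorem pow_rpow_eighth {a : ℝ} (ha : 0 ≤ a) (k : ℕ) : (a ^ (1 / 8 : ℝ)) ^ k = a ^ (k / 8 : ℝ) := by
  rw [← Real.rpow_natCast, ← Real.rpow_mul ha]
  congr 1
  ring

/-- The hypothesis `7/8 ≤ ρ₂` makes the eighth root of a cut-off an admissible weight. -/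
theorem IsSpaceCutoff.isEighthRoot {U A : Set E3} (hC₀ : 0 < C₀) (hR₀ : 0 < R₀) (hρ : 7 / 8 ≤ ρ₂)
    (h : IsSpaceCutoff C₀ ρ₂ R₀ U A ψ₀) :
    IsEighthRoot (C₀ / R₀) ψ₀ fun y => ψ₀ y ^ (1 / 8 : ℝ) where
  smooth := h.smooth
  compact := h.compact
  cont := h.smooth.continuous.rpow_const fun _ => Or.inr (by norm_num)
  nonneg y := Real.rpow_nonneg (h.nonneg y) _
  le_one y := Real.rpow_le_one (h.nonneg y) (h.le_one y) (by norm_num)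
  pow_eight y := by
    rw [pow_rpow_eighth (h.nonneg y)]
    norm_num
  grad_le y := by
    refine (h.grad_le y).trans (mul_le_mul_of_nonneg_left ?_ (by positivity))
    rw [pow_rpow_eighth (h.nonneg y)]
    exact Real.rpow_le_rpow_of_exponent_ge' (h.nonneg y) (h.le_one y) (by norm_num)
      (by exact_mod_cast hρ)

/-- The derivatives of the cut-offs add up to at most `K₂` times the bound for a single one. -/
theorem sum_rpow_cutoff_le (hR₀ : 0 < R₀)
    (h₀ : IsSpaceCutoff C₀ ρ₂ R₀ (ball 0 (2 * R₀)) (ball 0 R₀) ψ₀)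
    (hx : IsKCover K₁ K₂ R₀ R x) (hψ : ∀ i, IsCoverCutoff C₀ ρ₂ R₀ R ψ₀ (x i) (ψ i))
    {θ : ℝ} {k : ℕ} (hθ : 0 < θ) (hk : k / 8 ≤ θ) (y : E3) :
    ∑ i, ψ i y ^ θ ≤ K₂ * (ψ₀ y ^ (1 / 8 : ℝ)) ^ k := by
  have h0 := h₀.nonneg y
  rw [pow_rpow_eighth h0]
  refine sum_cutoff_le_of_card_le (Real.rpow_nonneg h0 _) ?_ fun i => ?_
  · refine le_trans (Finset.card_le_card fun i hi => ?_)
      (card_cutoff_ne_zero_le hR₀ h₀ hx hψ y)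
    simp only [Finset.mem_filter, Finset.mem_univ, true_and] at hi ⊢
    exact fun h => hi (by rw [h, Real.zero_rpow hθ.ne'])
  · exact (Real.rpow_le_rpow ((hψ i).nonneg y) ((hψ i).le_outer y) hθ.le).trans
      (Real.rpow_le_rpow_of_exponent_ge' h0 (h₀.le_one y) (by positivity) hk)

theorem isAggregate_sum (hC₀ : 0 < C₀) (hR₀ : 0 < R₀) (hρ : 7 / 8 ≤ ρ₂)
    (h₀ : IsSpaceCutoff C₀ ρ₂ R₀ (ball 0 (2 * R₀)) (ball 0 R₀) ψ₀)
    (hx : IsKCover K₁ K₂ R₀ R x) (hψ : ∀ i, IsCoverCutoff C₀ ρ₂ R₀ R ψ₀ (x i) (ψ i)) :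
    IsAggregate K₂ C₀ R ψ₀ (fun y => ψ₀ y ^ (1 / 8 : ℝ)) (fun y => ∑ i, ψ i y) := by
  have hR := hx.pos
  have hsp := fun i => (hψ i).exists_isSpaceCutoff
  choose U A hUA using hsp
  have hsm : ContDiff ℝ ∞ fun y => ∑ i, ψ i y := ContDiff.sum fun i _ => (hUA i).smooth
  refine ⟨⟨hsm, ?_, subset_univ _⟩, le_sum_cutoff hR₀ h₀ hx hψ, fun y => ?_, fun y => ?_,
    fun y => ?_⟩
  · refine h₀.compact.mono fun y hy => ?_
    rw [Function.mem_support] at hy ⊢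
    contrapose! hy
    exact Finset.sum_eq_zero fun i _ =>
      le_antisymm (((hψ i).le_outer y).trans hy.le) ((hψ i).nonneg y)
  · exact sum_cutoff_le_of_card_le (h₀.nonneg y) (card_cutoff_ne_zero_le hR₀ h₀ hx hψ y)
      (hψ · |>.le_outer y)
  · rw [fderiv_fun_sum fun i _ => (hUA i).smooth.differentiable (by simp) y]
    calc ‖∑ i, fderiv ℝ (ψ i) y‖ ≤ ∑ i, C₀ / R * ψ i y ^ ρ₂ :=
          (norm_sum_le _ _).trans (Finset.sum_le_sum fun i _ => (hUA i).grad_le y)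
      _ = C₀ / R * ∑ i, ψ i y ^ ρ₂ := by rw [Finset.mul_sum]
      _ ≤ C₀ / R * (K₂ * (ψ₀ y ^ (1 / 8 : ℝ)) ^ 7) :=
          mul_le_mul_of_nonneg_left (sum_rpow_cutoff_le hR₀ h₀ hx hψ (by linarith)
            (by exact_mod_cast hρ) y) (by positivity)
      _ = _ := by ring
  · have hlap : Δ (fun y => ∑ i, ψ i y) y = ∑ i, Δ (ψ i) y := by
      rw [laplacian_eq_sum_dd hsm]
      have hs := fun i => contDiffOn_univ.2 (hUA i).smooth
      have e1 : ∀ l, dd (e l) (dd (e l) fun y => ∑ i, ψ i y) y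
          = ∑ i, dd (e l) (dd (e l) (ψ i)) y := by
        intro l
        rw [dd_congr isOpen_univ (fun z hz => dd_sum isOpen_univ _ (fun i _ => hs i) hz)
          (mem_univ y)]
        exact dd_sum isOpen_univ _ (fun i _ => dd_smoothOn isOpen_univ (hs i) _) (mem_univ y)
      simp only [e1]
      rw [Finset.sum_comm]
      exact Finset.sum_congr rfl fun i _ => (laplacian_eq_sum_dd (hUA i).smooth y).symm
    rw [hlap]
    calc |∑ i, Δ (ψ i) y| ≤ ∑ i, C₀ / R ^ 2 * ψ i y ^ (2 * ρ₂ - 1) :=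
          (Finset.abs_sum_le_sum_abs _ _).trans (Finset.sum_le_sum fun i _ => (hUA i).lap_le y)
      _ = C₀ / R ^ 2 * ∑ i, ψ i y ^ (2 * ρ₂ - 1) := by rw [Finset.mul_sum]
      _ ≤ C₀ / R ^ 2 * (K₂ * (ψ₀ y ^ (1 / 8 : ℝ)) ^ 4) :=
          mul_le_mul_of_nonneg_left (sum_rpow_cutoff_le hR₀ h₀ hx hψ (by linarith)
            (by push_cast; linarith) y) (by positivity)
      _ = _ := by ring

end Aggregate

section Estimates

variable {u : ℝ → E3 → E3} {T s : ℝ} {f : ℝ × E3 → ℝ}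

theorem spaceInt_mono {Ψ₁ Ψ₂ : E3 → ℝ} (hf : ContinuousOn f (slab T)) (hf0 : ∀ z, 0 ≤ f z)
    (h1 : Continuous Ψ₁) (c1 : HasCompactSupport Ψ₁) (h2 : Continuous Ψ₂)
    (c2 : HasCompactSupport Ψ₂) (h : ∀ y, Ψ₁ y ≤ Ψ₂ y) (hs : s ∈ Ioo 0 T) :
    spaceInt f Ψ₁ s ≤ spaceInt f Ψ₂ s :=
  integral_mono (integrable_slice_mul hf h1 c1 hs) (integrable_slice_mul hf h2 c2 hs)
    fun y => mul_le_mul_of_nonneg_left (h y) (hf0 _)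

theorem spaceInt_const_mul (c : ℝ) (Ψ : E3 → ℝ) :
    spaceInt f (fun y => c * Ψ y) s = c * spaceInt f Ψ s := by
  rw [spaceInt, spaceInt, ← integral_const_mul]
  congr 1
  funext y
  ring

theorem spaceInt_nonneg {Ψ : E3 → ℝ} (hf0 : ∀ z, 0 ≤ f z) (h : ∀ y, 0 ≤ Ψ y) :
    0 ≤ spaceInt f Ψ s := integral_nonneg fun y => mul_nonneg (hf0 _) (h y)

theorem abs_spaceInt_le {Ψ₁ Ψ₂ : E3 → ℝ} (hf : ContinuousOn f (slab T)) (hf0 : ∀ z, 0 ≤ f z)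
    (h2 : Continuous Ψ₂) (c2 : HasCompactSupport Ψ₂) (h : ∀ y, |Ψ₁ y| ≤ Ψ₂ y)
    (hs : s ∈ Ioo 0 T) : |spaceInt f Ψ₁ s| ≤ spaceInt f Ψ₂ s := by
  rw [← Real.norm_eq_abs]
  refine norm_integral_le_of_norm_le (integrable_slice_mul hf h2 c2 hs)
    (Eventually.of_forall fun y => ?_)
  rw [norm_mul, Real.norm_of_nonneg (hf0 _)]
  exact mul_le_mul_of_nonneg_left (h y) (hf0 _)

variable {ψ₀ q Ψ : E3 → ℝ} {C₀ ρ₁ R₀ R A : ℝ} {K₂ : ℕ} {η : ℝ → ℝ}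

/-- The error terms of the localized enstrophy balance at one time, with the Sobolev constant `c`
and a free parameter `l` from Young's inequality. -/
theorem IsAggregate.abs_error_le (hu : IsRegularOn u T) (hM : M0 u T R₀ < ⊤)
    (hC₀ : 0 < C₀) (hR : 0 < R) (hT : 0 < T) (hρ : 1 / 2 < ρ₁)
    (hη : IsTimeCutoff C₀ ρ₁ T η) (hq : IsEighthRoot A ψ₀ q)
    (hsupp : tsupport ψ₀ ⊆ ball 0 (2 * R₀)) (hΨ : IsAggregate K₂ C₀ R ψ₀ q Ψ) {c : ℝ} (hc0 : 0 < c)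
    (hc : IsSobolevConst c)
    {l : ℝ} (hl : 0 < l) (hs : s ∈ Ioo 0 T) :
    |deriv η s * spaceInt (enst u) Ψ s + η s * spaceInt (enst u) (Δ Ψ) s
        + η s * ∑ l, spaceInt (fun z => comp u l z * enst u z) (dd (e l) Ψ) s|
      ≤ (K₂ * C₀ / T + K₂ * C₀ / R ^ 2 + K₂ * C₀ / (2 * R) * √(M0 u T R₀).toReal * c
          * (2 * l ^ 3 + A ^ 2 / l)) * (√(η s) * spaceInt (enst u) (fun y => q y ^ 4) s)
        + K₂ * C₀ / (2 * R) * √(M0 u T R₀).toReal * c * (2 / l)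
          * (η s * spaceInt (palin u) ψ₀ s) := by
  have hE := (enst_smoothOn hu).continuousOn
  have hE0 := enst_nonneg u
  have hη0 := hη.nonneg s hs
  have hη1 := hη.le_one s hs
  have hηs : η s ≤ √(η s) := by
    rw [Real.le_sqrt hη0 hη0]
    nlinarith
  have hηρ : η s ^ ρ₁ ≤ √(η s) := by
    rw [Real.sqrt_eq_rpow]
    exact Real.rpow_le_rpow_of_exponent_ge' hη0 hη1 (by norm_num) hρ.le
  have q4c : Continuous fun y => q y ^ 4 := hq.cont.pow 4
  have q4s : HasCompactSupport fun y => q y ^ 4 := hq.hasCompactSupport.mono fun y hy => by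
    rw [Function.mem_support] at hy ⊢
    contrapose! hy
    simp [hy]
  set ee := spaceInt (enst u) (fun y => q y ^ 4) s with hee
  set dp := spaceInt (palin u) ψ₀ s with hdp
  have hee0 : 0 ≤ ee := spaceInt_nonneg hE0 fun y => by have := hq.nonneg y; positivity
  have hψ0 : ∀ y, 0 ≤ ψ₀ y := fun y => by rw [← hq.pow_eight]; have := hq.nonneg y; positivity
  have hdp0 : 0 ≤ dp := spaceInt_nonneg (palin_nonneg u) hψ0
  -- the time derivative of the temporal cut-off
  have b1 : |deriv η s * spaceInt (enst u) Ψ s| ≤ K₂ * C₀ / T * (√(η s) * ee) := by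
    have h1 : |deriv η s| ≤ C₀ / T * √(η s) :=
      (hη.deriv_le s hs).trans (mul_le_mul_of_nonneg_left hηρ (by positivity))
    have h2 : |spaceInt (enst u) Ψ s| ≤ K₂ * ee := by
      rw [hee, ← spaceInt_const_mul]
      refine abs_spaceInt_le hE hE0 (by fun_prop) q4s.mul_left (fun y => ?_) hs
      rw [abs_of_nonneg ((hψ0 y).trans (hΨ.ge y))]
      refine (hΨ.le y).trans (mul_le_mul_of_nonneg_left ?_ (by positivity))
      rw [← hq.pow_eight]
      exact pow_le_pow_of_le_one (hq.nonneg y) (hq.le_one y) (by norm_num)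
    rw [abs_mul]
    calc _ ≤ C₀ / T * √(η s) * (K₂ * ee) := mul_le_mul h1 h2 (abs_nonneg _) (by positivity)
      _ = _ := by ring
  -- the Laplacian of the spatial cut-off
  have b2 : |η s * spaceInt (enst u) (Δ Ψ) s| ≤ K₂ * C₀ / R ^ 2 * (√(η s) * ee) := by
    have h2 : |spaceInt (enst u) (Δ Ψ) s| ≤ K₂ * C₀ / R ^ 2 * ee := by
      rw [hee, ← spaceInt_const_mul]
      exact abs_spaceInt_le hE hE0 (by fun_prop) q4s.mul_left hΨ.lap_le hs
    rw [abs_mul, abs_of_nonneg hη0]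
    calc _ ≤ √(η s) * (K₂ * C₀ / R ^ 2 * ee) := mul_le_mul hηs h2 (abs_nonneg _) (by positivity)
      _ = _ := by ring
  -- the transport term
  have hcurl := curl_contDiff hu hs
  have huc : Continuous (u s) := (smooth_slice hu hs).continuous
  have tr := hq.integral_transport_le hc0 hc hcurl huc hsupp (integral_norm_sq_le_M0 hu hM hs) hl
  have f1 : ∫ x, ‖curl (u s) x‖ ^ 2 * q x ^ 4 = 2 * ee := by
    simp only [norm_curl_sq hu hs, mul_assoc]
    rw [integral_const_mul]
    rfl
  have f2 : ∫ x, frobSq (fderiv ℝ (curl (u s)) x) * q x ^ 8 = dp := by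
    simp only [frobSq_curl hu hs, hq.pow_eight]
    rfl
  rw [f1, f2] at tr
  have b3 : |∑ l, spaceInt (fun z => comp u l z * enst u z) (dd (e l) Ψ) s|
      ≤ K₂ * C₀ / (2 * R) * ∫ x, ‖u s x‖ * ‖curl (u s) x‖ ^ 2 * q x ^ 7 := by
    have g1 : ∑ l, spaceInt (fun z => comp u l z * enst u z) (dd (e l) Ψ) s
        = ∫ x, enst u (s, x) * fderiv ℝ Ψ x (u s x) := by
      simp only [spaceInt]
      rw [← integral_finsetSum _ fun l _ => integrable_slice_mul
        ((comp_smoothOn hu l).mul (enst_smoothOn hu)).continuousOn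
        (hΨ.bump.dd (e l)).smooth.continuous (hΨ.bump.dd (e l)).compact hs]
      congr 1
      funext x
      conv_rhs => rw [sum_coord_smul_e (u s x), map_sum, Finset.mul_sum]
      refine Finset.sum_congr rfl fun l _ => ?_
      rw [map_smul]
      simp only [comp, dd, smul_eq_mul]
      ring
    rw [g1, ← integral_const_mul, ← Real.norm_eq_abs]
    refine norm_integral_le_of_norm_le
      ((hq.integrable_mul_pow (huc.norm.mul (hcurl.continuous.norm.pow 2)) (n := 7)
        (by norm_num)).const_mul _) (Eventually.of_forall fun x => ?_)
    have g2 : ‖fderiv ℝ Ψ x (u s x)‖ ≤ K₂ * C₀ / R * q x ^ 7 * ‖u s x‖ :=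
      ((fderiv ℝ Ψ x).le_opNorm _).trans (mul_le_mul_of_nonneg_right (hΨ.grad_le x)
        (norm_nonneg _))
    rw [norm_mul, Real.norm_of_nonneg (hE0 _), norm_curl_sq hu hs]
    calc _ ≤ enst u (s, x) * (K₂ * C₀ / R * q x ^ 7 * ‖u s x‖) :=
          mul_le_mul_of_nonneg_left g2 (hE0 _)
      _ = _ := by field_simp
  set m := √(M0 u T R₀).toReal with hm
  have hm0 : 0 ≤ m := Real.sqrt_nonneg _
  have b4 : |η s * ∑ l, spaceInt (fun z => comp u l z * enst u z) (dd (e l) Ψ) s|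
      ≤ K₂ * C₀ / (2 * R) * (m * (c * (l ^ 3 * (2 * (√(η s) * ee))
        + (2 * (η s * dp) + A ^ 2 / 2 * (2 * (√(η s) * ee))) / l))) := by
    rw [abs_mul, abs_of_nonneg hη0]
    have hB : 0 ≤ K₂ * C₀ / (2 * R) := by positivity
    calc _ ≤ η s * (K₂ * C₀ / (2 * R) * (m * (c * (l ^ 3 * (2 * ee)
          + (2 * dp + A ^ 2 / 2 * (2 * ee)) / l)))) :=
          mul_le_mul_of_nonneg_left (b3.trans (mul_le_mul_of_nonneg_left tr hB)) hη0
      _ = K₂ * C₀ / (2 * R) * (m * (c * (l ^ 3 * (2 * (η s * ee))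
          + (2 * (η s * dp) + A ^ 2 / 2 * (2 * (η s * ee))) / l))) := by ring
      _ ≤ _ := by gcongr
  refine (abs_add_three _ _ _).trans ((add_le_add (add_le_add b1 b2) b4).trans (le_of_eq ?_))
  field_simp
  ring

end Estimates

section Algebra

/-- The choice of the Young parameter `l = C m / R` makes the error terms small: here `τ = σ^{1/2}`,
`m = max (√M₀) 1`, and `p` is `P₀` up to normalization. -/
theorem error_le_half {K C₀ T R R₀ M m c C τ p Ei D : ℝ} (hK : 0 ≤ K) (hC₀ : 0 < C₀)
    (hR : 0 < R) (hR₀ : R ≤ R₀) (hR₀T : R₀ ^ 2 ≤ T) (hT1 : T ≤ 1) (hM : 0 ≤ M) (hMm : M ≤ m)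
    (hm : 1 ≤ m) (hc : 0 < c) (hC : 1 ≤ C) (hC1 : 8 * K * C₀ ≤ C)
    (hC2 : 2 * K * C₀ * c * (4 + C₀ ^ 2) ≤ C) (hτ : 0 ≤ τ) (hτR : C * m * τ ≤ R) (hp : 0 ≤ p)
    (hE : Ei = τ ^ 4 * p) (hD : D ≤ p) :
    (K * C₀ / T + K * C₀ / R ^ 2 + K * C₀ / (2 * R) * M * c
          * (2 * (C * m / R) ^ 3 + (C₀ / R₀) ^ 2 / (C * m / R))) * Ei
        + K * C₀ / (2 * R) * M * c * (2 / (C * m / R)) * D ≤ p / 2 := by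
  have hR₀pos : 0 < R₀ := hR.trans_le hR₀
  have hR1 : R ≤ 1 := by nlinarith
  have hC0 : 0 < C := by linarith
  have hm0 : 0 < m := by linarith
  set l := C * m / R with hl
  have hlpos : 0 < l := by positivity
  have hlτ : l * τ ≤ 1 := by rw [hl, div_mul_eq_mul_div, div_le_one hR]; exact hτR
  have hl4 : (l * τ) ^ 4 ≤ 1 := pow_le_one₀ (by positivity) hlτ
  have hCτ : C * τ ≤ R := by
    refine le_trans ?_ hτR
    exact mul_le_mul_of_nonneg_right (by nlinarith) hτ
  have hτle : τ ≤ R := by nlinarith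
  -- the time derivative and the Laplacian of the cut-off
  have a1 : (K * C₀ / T + K * C₀ / R ^ 2) * Ei ≤ p / 4 := by
    have h1 : K * C₀ / T ≤ K * C₀ / R ^ 2 := by
      refine div_le_div_of_nonneg_left (by positivity) (by positivity) ?_
      nlinarith
    have h2 : C * τ ^ 4 ≤ R ^ 2 := by
      calc C * τ ^ 4 = (C * τ) * τ ^ 3 := by ring
        _ ≤ R * R ^ 3 := mul_le_mul hCτ (pow_le_pow_left₀ hτ hτle 3) (by positivity) hR.le
        _ = R ^ 2 * R ^ 2 := by ring
        _ ≤ R ^ 2 * 1 := mul_le_mul_of_nonneg_left (pow_le_one₀ hR.le hR1) (by positivity)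
        _ = R ^ 2 := mul_one _
    have h3 : 2 * (K * C₀ / R ^ 2) * τ ^ 4 ≤ 1 / 4 := by
      rw [show 2 * (K * C₀ / R ^ 2) * τ ^ 4 = 2 * K * C₀ * τ ^ 4 / R ^ 2 by ring,
        div_le_iff₀ (by positivity)]
      have := mul_le_mul_of_nonneg_right hC1 (by positivity : 0 ≤ τ ^ 4)
      nlinarith
    calc (K * C₀ / T + K * C₀ / R ^ 2) * Ei ≤ (2 * (K * C₀ / R ^ 2)) * Ei :=
          mul_le_mul_of_nonneg_right (by linarith) (by rw [hE]; positivity)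
      _ = 2 * (K * C₀ / R ^ 2) * τ ^ 4 * p := by rw [hE]; ring
      _ ≤ 1 / 4 * p := mul_le_mul_of_nonneg_right h3 hp
      _ = p / 4 := by ring
  -- the transport term
  have a2 : K * C₀ / (2 * R) * M * c * ((2 * l ^ 3 + (C₀ / R₀) ^ 2 / l) * Ei + 2 / l * D)
      ≤ p / 4 := by
    have h1 : l ^ 3 * τ ^ 4 ≤ 1 / l := by
      rw [le_div_iff₀ hlpos]
      calc l ^ 3 * τ ^ 4 * l = (l * τ) ^ 4 := by ring
        _ ≤ 1 := hl4
    have h2 : (C₀ / R₀) ^ 2 * τ ^ 4 ≤ C₀ ^ 2 := by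
      rw [div_pow, div_mul_eq_mul_div, div_le_iff₀ (by positivity)]
      refine mul_le_mul_of_nonneg_left ?_ (by positivity)
      calc τ ^ 4 ≤ R ^ 4 := pow_le_pow_left₀ hτ hτle 4
        _ ≤ R ^ 2 := pow_le_pow_of_le_one hR.le hR1 (by norm_num)
        _ ≤ R₀ ^ 2 := pow_le_pow_left₀ hR.le hR₀ 2
    have h3 : (2 * l ^ 3 + (C₀ / R₀) ^ 2 / l) * Ei + 2 / l * D ≤ (4 + C₀ ^ 2) / l * p := by
      calc _ = (2 * (l ^ 3 * τ ^ 4) + (C₀ / R₀) ^ 2 * τ ^ 4 / l) * p + 2 / l * D := by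
            rw [hE]; ring
        _ ≤ (2 * (1 / l) + C₀ ^ 2 / l) * p + 2 / l * p := by gcongr
        _ = _ := by ring
    calc _ ≤ K * C₀ / (2 * R) * m * c * ((4 + C₀ ^ 2) / l * p) := by
          have hE0 : 0 ≤ Ei := by rw [hE]; positivity
          refine mul_le_mul_of_nonneg_left h3 (by positivity) |>.trans ?_
          gcongr
      _ = 2 * K * C₀ * c * (4 + C₀ ^ 2) / C * (p / 4) := by
          rw [hl]
          field_simp
          ring
      _ ≤ 1 * (p / 4) := by
          refine mul_le_mul_of_nonneg_right ?_ (by positivity)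
          rw [div_le_one hC0]
          exact hC2
      _ = p / 4 := one_mul _
  linarith

end Algebra

/-! ### Comparison of vortex stretching and palinstrophy -/

section Average

variable {u₀ : E3 → E3} {u : ℝ → E3 → E3} {G : ℝ → E3 → (E3 →L[ℝ] E3)} {p : ℝ → E3 → ℝ}
  {T t R R₀ C₀ ρ₁ ρ₂ : ℝ} {η : ℝ → ℝ} {ψ₀ : E3 → ℝ} {K₁ K₂ n : ℕ} {x : Fin n → E3}
  {ψ : Fin n → E3 → ℝ}

theorem intervalIntegrable_cutoff_mul (hη : IsTimeCutoff C₀ ρ₁ T η) (ht : t ∈ Ioo (2 * T / 3) T)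
    {f : ℝ → ℝ} (hf : ContinuousOn f (Ioo 0 T)) :
    IntervalIntegrable (fun s => η s * f s) volume 0 t :=
  (intervalIntegrable_of_eq_zero (hη.smooth.continuousOn.mul hf)
    (fun s hs => by simp [hη.eq_zero s hs]) ht).1

theorem VSTavg_eq (hu : IsRegularOn u T) (hη : IsTimeCutoff C₀ ρ₁ T η)
    (ht : t ∈ Ioo (2 * T / 3) T) (ht0 : 0 < t) (hψ : ∀ i, Continuous (ψ i))
    (hc : ∀ i, HasCompactSupport (ψ i)) :
    VSTavg u η ψ R t = 1 / n * (1 / t * (1 / R ^ 3)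
      * ∫ s in 0..t, η s * spaceInt (stretch u) (fun y => ∑ i, ψ i y) s) := by
  have hS := (stretch_smoothOn hu).continuousOn
  rw [VSTavg]
  congr 1
  simp only [VST_eq hu ht0 ht.2]
  rw [← Finset.mul_sum, ← intervalIntegral.integral_finsetSum fun i _ =>
    intervalIntegrable_cutoff_mul hη ht (spaceInt_continuousOn hS (hψ i) (hc i))]
  congr 1
  refine intervalIntegral_congr_Ioo ht0 ht.2 fun s hs => ?_
  rw [← Finset.mul_sum]
  congr 1
  simp only [spaceInt]
  rw [← integral_finsetSum _ fun i _ => integrable_slice_mul hS (hψ i) (hc i) hs]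
  simp only [Finset.mul_sum]

/-- Up to normalization, the vortex-stretching term localized by `Ψ` is comparable to the
palinstrophy localized by `ψ₀` as soon as the error terms are at most half of the latter. -/
theorem stretch_comparable (h : IsLocalLerayWith u₀ u G p) (hu : IsRegularOn u T) (hT : 0 < T)
    (hη : IsTimeCutoff C₀ ρ₁ T η) (ht : t ∈ Ioo (2 * T / 3) T) {q Ψ : E3 → ℝ} {A : ℝ}
    (hq : IsEighthRoot A ψ₀ q) (hΨ : IsAggregate K₂ C₀ R ψ₀ q Ψ) {a b : ℝ}
    (herr : ∀ s ∈ Ioo 0 T, |deriv η s * spaceInt (enst u) Ψ s + η s * spaceInt (enst u) (Δ Ψ) s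
        + η s * ∑ l, spaceInt (fun z => comp u l z * enst u z) (dd (e l) Ψ) s|
      ≤ a * (√(η s) * spaceInt (enst u) (fun y => q y ^ 4) s)
        + b * (η s * spaceInt (palin u) ψ₀ s)) :
    (∫ s in 0..t, η s * spaceInt (palin u) ψ₀ s) + spaceInt (enst u) ψ₀ t
      - (a * (∫ s in 0..t, √(η s) * spaceInt (enst u) (fun y => q y ^ 4) s)
        + b * ∫ s in 0..t, η s * spaceInt (palin u) ψ₀ s)
      ≤ ∫ s in 0..t, η s * spaceInt (stretch u) Ψ s ∧
    ∫ s in 0..t, η s * spaceInt (stretch u) Ψ s ≤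
      K₂ * ((∫ s in 0..t, η s * spaceInt (palin u) ψ₀ s) + spaceInt (enst u) ψ₀ t)
      + (a * (∫ s in 0..t, √(η s) * spaceInt (enst u) (fun y => q y ^ 4) s)
        + b * ∫ s in 0..t, η s * spaceInt (palin u) ψ₀ s) := by
  have ht0 : 0 < t := by linarith [ht.1]
  have htI : t ∈ Ioo 0 T := ⟨ht0, ht.2⟩
  have hE := (enst_smoothOn hu).continuousOn
  have hP := (palin_smoothOn hu).continuousOn
  have hΨc := hΨ.bump.smooth.continuous
  have hψc := hq.smooth.continuous
  have q4s : HasCompactSupport fun y => q y ^ 4 := hq.hasCompactSupport.mono fun y hy => by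
    rw [Function.mem_support] at hy ⊢
    contrapose! hy
    simp [hy]
  have kψc : Continuous fun y => (K₂ : ℝ) * ψ₀ y := by fun_prop
  have kψs : HasCompactSupport fun y => (K₂ : ℝ) * ψ₀ y := hq.compact.mul_left
  have iD := intervalIntegrable_cutoff_mul hη ht (spaceInt_continuousOn hP hψc hq.compact)
  have iDΨ := intervalIntegrable_cutoff_mul hη ht (spaceInt_continuousOn hP hΨc hΨ.bump.compact)
  have iE : IntervalIntegrable (fun s => √(η s) * spaceInt (enst u) (fun y => q y ^ 4) s)
      volume 0 t := (intervalIntegrable_of_eq_zero ((hη.smooth.continuousOn.sqrt).mul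
    (spaceInt_continuousOn hE (hq.cont.pow 4) q4s))
    (fun s hs => by simp [hη.eq_zero s hs]) ht).1
  have e1 := spaceInt_mono hE (enst_nonneg u) hψc hq.compact hΨc hΨ.bump.compact hΨ.ge htI
  have e2 := spaceInt_mono hE (enst_nonneg u) hΨc hΨ.bump.compact kψc kψs hΨ.le htI
  rw [spaceInt_const_mul] at e2
  have d1 := intervalIntegral.integral_mono_on_of_le_Ioo ht0.le iD iDΨ fun s hs =>
    mul_le_mul_of_nonneg_left (spaceInt_mono hP (palin_nonneg u) hψc hq.compact hΨc
      hΨ.bump.compact hΨ.ge ⟨hs.1, hs.2.trans ht.2⟩) (hη.nonneg s ⟨hs.1, hs.2.trans ht.2⟩)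
  have d2 : ∫ s in 0..t, η s * spaceInt (palin u) Ψ s
      ≤ K₂ * ∫ s in 0..t, η s * spaceInt (palin u) ψ₀ s := by
    rw [← intervalIntegral.integral_const_mul]
    refine intervalIntegral.integral_mono_on_of_le_Ioo ht0.le iDΨ (iD.const_mul _) fun s hs => ?_
    have hs' : s ∈ Ioo 0 T := ⟨hs.1, hs.2.trans ht.2⟩
    have := mul_le_mul_of_nonneg_left (spaceInt_mono hP (palin_nonneg u) hΨc hΨ.bump.compact kψc
      kψs hΨ.le hs') (hη.nonneg s hs')
    rw [spaceInt_const_mul] at this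
    linarith
  have hL := intervalIntegral.norm_integral_le_of_norm_le ht0.le
    (f := fun s => deriv η s * spaceInt (enst u) Ψ s + η s * spaceInt (enst u) (Δ Ψ) s
        + η s * ∑ l, spaceInt (fun z => comp u l z * enst u z) (dd (e l) Ψ) s)
    (Eventually.of_forall fun s hs => herr s ⟨hs.1, hs.2.trans_lt ht.2⟩)
    ((iE.const_mul a).add (iD.const_mul b))
  have hL' := hL.trans (le_of_eq (intervalIntegral.integral_add (iE.const_mul a) (iD.const_mul b)))
  rw [intervalIntegral.integral_const_mul, intervalIntegral.integral_const_mul,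
    Real.norm_eq_abs] at hL'
  have hid := intervalIntegral_enstrophy_balance h hu hΨ.bump hη.smooth hη.eq_zero ht
    (hη.eq_one t ht)
  obtain ⟨l1, l2⟩ := abs_le.1 hL'
  constructor
  · linarith
  · linarith

end Average

end VortexStretching

theorem theorem2 (K₁ K₂ : ℕ) (hK₁ : 0 < K₁) (hK₂ : 0 < K₂) (C₀ : ℝ) (hC₀ : 0 < C₀) :
    ∃ C : ℝ, 1 < C ∧
      ∀ (ρ₁ ρ₂ : ℝ), 1 / 2 < ρ₁ → ρ₁ < 1 → 7 / 8 ≤ ρ₂ → ρ₂ < 1 →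
      ∀ (T R₀ : ℝ), 0 < T → T ≤ 1 → 0 < R₀ → R₀ ≤ √T →
      ∀ (u : ℝ → E3 → E3), IsLocalLeray u → IsRegularOn u T →
        M0 u T R₀ < ⊤ ∧
        ∀ (η : ℝ → ℝ) (ψ₀ : E3 → ℝ), IsTimeCutoff C₀ ρ₁ T η →
          IsSpaceCutoff C₀ ρ₂ R₀ (ball 0 (2 * R₀)) (ball 0 R₀) ψ₀ →
        ∀ t ∈ Ioo (2 * T / 3) T, 0 < P0 u η ψ₀ R₀ t →
          C * max (√(M0 u T R₀).toReal) 1 * √(sigma0 u η ψ₀ R₀ t) < R₀ →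
        ∀ R : ℝ, C * max (√(M0 u T R₀).toReal) 1 * √(sigma0 u η ψ₀ R₀ t) ≤ R → R ≤ R₀ →
        ∀ (n : ℕ) (x : Fin n → E3), IsKCover K₁ K₂ R₀ R x →
        ∀ ψ : Fin n → E3 → ℝ, (∀ i, IsCoverCutoff C₀ ρ₂ R₀ R ψ₀ (x i) (ψ i)) →
          1 / C * P0 u η ψ₀ R₀ t ≤ VSTavg u η ψ R t ∧
          VSTavg u η ψ R t ≤ C * P0 u η ψ₀ R₀ t ∧
          0 < VSTavg u η ψ R t := by
  obtain ⟨c, hc0, hc⟩ := exists_isSobolevConst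
  have hK₁' : (1 : ℝ) ≤ K₁ := by exact_mod_cast hK₁
  have hK₂' : (1 : ℝ) ≤ K₂ := by exact_mod_cast hK₂
  have hB1 : 0 ≤ 8 * K₂ * C₀ := by positivity
  have hB2 : 0 ≤ 2 * K₂ * C₀ * c * (4 + C₀ ^ 2) := by positivity
  set C : ℝ := 2 * K₁ + K₂ + 8 * K₂ * C₀ + 2 * K₂ * C₀ * c * (4 + C₀ ^ 2) with hC
  have hC1 : 1 < C := by linarith
  refine ⟨C, hC1, ?_⟩
  intro ρ₁ ρ₂ hρ₁ _ hρ₂ _ T R₀ hT hT1 hR₀ hR₀T u hL hu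
  have hM := M0_lt_top (R₀ := R₀) hL hu hT
  refine ⟨hM, ?_⟩
  intro η ψ₀ hη hψ₀ t ht hP0 _ R hRle hRR₀ n x hx ψ hψ
  obtain ⟨u₀, G, p, h⟩ := hL
  have hR := hx.pos
  have ht0 : 0 < t := by linarith [ht.1]
  have hq := hψ₀.isEighthRoot hC₀ hR₀ hρ₂
  have hΨ := isAggregate_sum hC₀ hR₀ hρ₂ hψ₀ hx hψ
  set q : E3 → ℝ := fun y => ψ₀ y ^ (1 / 8 : ℝ) with hqdef
  set Ψ : E3 → ℝ := fun y => ∑ i, ψ i y with hΨdef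
  have hPeq := P0_eq (η := η) (ψ := ψ₀) (R := R₀) hu ht0 ht.2
  have hEeq := E0_eq (η := η) (ψ := ψ₀) (R := R₀) hu ht0 ht.2 hq.nonneg hq.pow_eight
  set D := ∫ s in 0..t, η s * spaceInt (palin u) ψ₀ s with hD
  set b := spaceInt (enst u) ψ₀ t with hb
  set Ei := ∫ s in 0..t, √(η s) * spaceInt (enst u) (fun y => q y ^ 4) s with hEi
  set N := 1 / t * (1 / R₀ ^ 3) with hN
  have hNpos : 0 < N := by positivity
  have hp : 0 < D + b := by
    rw [hPeq] at hP0
    exact (mul_pos_iff_of_pos_left hNpos).1 hP0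
  have hb0 : 0 ≤ b := spaceInt_nonneg (enst_nonneg u) hψ₀.nonneg
  have hEi0 : 0 ≤ Ei := by
    refine intervalIntegral.integral_nonneg ht0.le fun s _ => mul_nonneg (Real.sqrt_nonneg _) ?_
    exact spaceInt_nonneg (enst_nonneg u) fun y => by have := hq.nonneg y; positivity
  set τ := √(sigma0 u η ψ₀ R₀ t) with hτ
  have hτ4 : Ei = τ ^ 4 * (D + b) := by
    have h1 : sigma0 u η ψ₀ R₀ t = √(Ei / (D + b)) := by
      rw [sigma0, hEeq, hPeq, mul_div_mul_left _ _ hNpos.ne']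
    have h2 : τ ^ 4 = Ei / (D + b) := by
      rw [show τ ^ 4 = (τ ^ 2) ^ 2 by ring, hτ, Real.sq_sqrt (h1 ▸ Real.sqrt_nonneg _), h1,
        Real.sq_sqrt (div_nonneg hEi0 hp.le)]
    rw [h2, div_mul_cancel₀ _ hp.ne']
  set m := max (√(M0 u T R₀).toReal) 1 with hm
  have hm1 : 1 ≤ m := le_max_right _ _
  have hR₀T' : R₀ ^ 2 ≤ T := (Real.le_sqrt hR₀.le hT.le).1 hR₀T
  have hl : 0 < C * m / R := by positivity
  have herr := fun s (hs : s ∈ Ioo 0 T) => hΨ.abs_error_le hu hM hC₀ hR hT hρ₁ hη hq hψ₀.supp hc0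
    hc hl hs
  have hcomp := stretch_comparable h hu hT hη ht hq hΨ herr
  have hsmall := error_le_half (K := K₂) (T := T) (R := R) (R₀ := R₀)
    (M := √(M0 u T R₀).toReal) (m := m) (c := c) (C := C) (by positivity) hC₀ hR hRR₀ hR₀T' hT1
    (Real.sqrt_nonneg _) (le_max_left _ _) hm1 hc0 hC1.le (by linarith) (by linarith)
    (Real.sqrt_nonneg _) hRle hp.le hτ4 (by linarith : D ≤ D + b)
  have hVeq := VSTavg_eq (R := R) hu hη ht ht0
    (fun i => (hψ i).exists_isSpaceCutoff.choose_spec.choose_spec.smooth.continuous)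
    (fun i => (hψ i).exists_isSpaceCutoff.choose_spec.choose_spec.compact)
  set V := ∫ s in 0..t, η s * spaceInt (stretch u) Ψ s with hV
  obtain ⟨lo, hi⟩ := hcomp
  have lo' : (D + b) / 2 ≤ V := by linarith
  have hi' : V ≤ (K₂ + 1) * (D + b) := by linarith
  have hV0 : 0 < V := by linarith
  -- the cardinality of the cover makes `1 / (n R³)` comparable to `1 / R₀³`
  have hcard1 := hx.card_ge
  have hcard2 := hx.card_le
  rw [div_pow] at hcard1 hcard2
  have hR3 : 0 < R ^ 3 := by positivity
  have hR₀3 : 0 < R₀ ^ 3 := by positivity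
  have hn0 : (0 : ℝ) < n := lt_of_lt_of_le (by positivity) hcard1
  have n1 : R₀ ^ 3 ≤ n * R ^ 3 := (div_le_iff₀ hR3).1 hcard1
  have n2 : n * R ^ 3 ≤ K₁ * R₀ ^ 3 := by
    have := mul_le_mul_of_nonneg_right hcard2 hR3.le
    rwa [show K₁ * (R₀ ^ 3 / R ^ 3) * R ^ 3 = K₁ * R₀ ^ 3 by field_simp] at this
  have hVform : VSTavg u η ψ R t = 1 / t * (1 / (n * R ^ 3)) * V := by
    rw [hVeq]
    field_simp
  have f1 : 1 / (n * R ^ 3) ≤ 1 / R₀ ^ 3 := one_div_le_one_div_of_le hR₀3 n1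
  have f2 : 1 / K₁ * (1 / R₀ ^ 3) ≤ 1 / (n * R ^ 3) := by
    rw [one_div_mul_one_div]
    exact one_div_le_one_div_of_le (by positivity) n2
  rw [hVform, hPeq]
  refine ⟨?_, ?_, by positivity⟩
  · calc 1 / C * (N * (D + b)) ≤ 1 / (2 * K₁) * (N * (D + b)) := by
          refine mul_le_mul_of_nonneg_right ?_ (by positivity)
          exact one_div_le_one_div_of_le (by positivity) (by linarith)
      _ = 1 / t * (1 / K₁ * (1 / R₀ ^ 3)) * ((D + b) / 2) := by
          rw [hN]
          field_simp
      _ ≤ 1 / t * (1 / (n * R ^ 3)) * V := by gcongr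
  · calc 1 / t * (1 / (n * R ^ 3)) * V ≤ 1 / t * (1 / R₀ ^ 3) * ((K₂ + 1) * (D + b)) := by gcongr
      _ = (K₂ + 1) * (N * (D + b)) := by rw [hN]; ring
      _ ≤ C * (N * (D + b)) :=
          mul_le_mul_of_nonneg_right (by linarith) (by positivity)
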